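/- Fix $n$. A multi-polynomial (MP) is an $n$-tuple of polynomials in $x_1,\dots,x_n$ with non-negative integer coefficients; a $\tau$-MP is an $n$-tuple of such polynomials in $x_1,\dots,x_n,\tau$. Composition $\vec q\circ\vec p$ substitutes $\vec p[i]$ for $x_i$ in $\vec q$ and leaves $\tau$ unchanged; $\mathit{Id}=\langle x_1,\dots,x_n\rangle$. A simple disjunctive loop (SDL) is a finite set $\mathcal S$ of MPs, here such that every component of every $\vec p\in\mathcal S$ depends on at least one variable (is not a constant polynomial). A trace over $\mathcal S$ is a finite, possibly empty, sequence $\sigma=\vec p_1;\dots;\vec p_k$ of elements of $\mathcal S$; its weight is $|\sigma|=k$, and it takes a state $\vec x\in\mathbb N^n$ to $[\![\sigma]\!](\vec x)=(\vec p_k\circ\dots\circ\vec p_1)(\vec x)$. $\mathcal S$ is polynomially bounded if for every $j$ there is a polynomial $p$ in $x_1,\dots,x_n,\tau$ with non-negative integer coefficients such that $[\![\sigma]\!](\vec x)_j\le p(\vec x,|\sigma|)$ for all traces $\sigma$ over $\mathcal S$ and all $\vec x\in\mathbb N^n$. A $\tau$-MP $\vec p$ bounds a trace $\sigma$ if $[\![\sigma]\!](\vec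 x)_j\le\vec p[j](\vec x,t)$ for all $j$, all $\vec x\in\mathbb N^n$ and all integers $t\ge|\sigma|$. An abstract $\tau$-MP is an $n$-tuple of finite sets of monomials in $x_1,\dots,x_n,\tau$, read as sums of distinct monomials with coefficient $1$. The abstraction $\alpha$ replaces all non-zero coefficients of a $\tau$-MP by $1$, and $\gamma$ reads an abstract $\tau$-MP as an ordinary one. Abstract composition is $\vec q\circledcirc\vec p=\alpha(\gamma(\vec q)\circ\gamma(\vec p))$, and $\vec p$ is idempotent if $\vec p\circledcirc\vec p=\vec p$. For a set $T$ of abstract $\tau$-MPs, $\mathrm{Cl}(T)$ consists of $\mathit{Id}$ and all finite abstract compositions of elements of $T$. The variable $x_i$ is self-dependent in $\vec p$ if it occurs in $\vec p[i]$, and a monomial is self-dependent if all the variables $x_j$ in it are. For idempotent $\vec p$, the generalization $\vec p^{\,\tau}$ is defined by $\vec p^{\,\tau}[i]=\vec p[i]$ if $x_i$ is not self-dependent in $\vec p$, and otherwise (abstractly) $$\vec p^{\,\tau}[i]=x_i+\tau\,\vec p[i]'+\tau\,\vec p[i]''+\vec p[i]''',$$ where $\tau\,\vec p[i]'$ is the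 sum of the self-dependent monomials of $\vec p[i]$ other than $x_i$ that contain $\tau$, $\vec p[i]''$ is the sum of the self-dependent monomials other than $x_i$ that do not contain $\tau$, and $\vec p[i]'''$ is the sum of the monomials that are not self-dependent. The algorithm $\mathrm{Solve}(\mathcal S)$ starts with $T=\alpha(\mathcal S)$ and repeats the following round until $T$ no longer changes, and then returns $T$: replace $T$ by $\mathrm{Cl}(T)$, then add $\vec p^{\,\tau}$ for every idempotent $\vec p\in T$. **Theorem (upper-bound correctness).** Let $\mathcal S$ be a polynomially bounded SDL. Then $\mathrm{Solve}(\mathcal S)$ stops after finitely many rounds and returns a finite set $\mathcal A$ of abstract $\tau$-MPs, and there is a finite set $\mathcal B$ of $\tau$-MPs such that $\alpha(\mathcal B)\subseteq\mathcal A$ and every trace $\sigma$ over $\mathcal S$ is bounded by some $\vec p\in\mathcal B$. -/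

import Mathlib

namespace SDL

noncomputable section

/-! ## Polynomials, multi-polynomials and `τ`-multi-polynomials -/

/-- Multi-polynomials: `n`-tuples of polynomials in `x_1, …, x_n` with natural coefficients. -/
abbrev MPol (n : ℕ) : Type := Fin n → MvPolynomial (Fin n) ℕ

/-- `τ`-polynomials: polynomials in `x_1, …, x_n` and `τ`.
The index `some i` stands for `x_i`, the index `none` stands for `τ`. -/
abbrev TauPol (n : ℕ) : Type := MvPolynomial (Option (Fin n)) ℕ

/-- `τ`-multi-polynomials: `n`-tuples of `τ`-polynomials. -/
abbrev TauMPol (n : ℕ) : Type := Fin n → TauPol n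

/-- The value `p(x, t)` of a `τ`-polynomial. -/
def TauPol.value {n : ℕ} (p : TauPol n) (x : Fin n → ℕ) (t : ℕ) : ℕ :=
  MvPolynomial.eval (fun o : Option (Fin n) => o.elim t x) p

/-- A multi-polynomial seen as a (`τ`-free) `τ`-multi-polynomial. -/
def MPol.toTau {n : ℕ} (p : MPol n) : TauMPol n :=
  fun i => MvPolynomial.rename some (p i)

/-- Composition `q ∘ p`: every `x_j` in `q` is replaced by `p j`, and `τ` is left alone. -/
def TauMPol.comp {n : ℕ} (q p : TauMPol n) : TauMPol n :=
  fun i => MvPolynomial.bind₁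
    (fun o : Option (Fin n) => o.elim (MvPolynomial.X none) p) (q i)

/-! ## Abstract `τ`-multi-polynomials -/

/-- Monomials in `x_1, …, x_n, τ`, given by their exponents. -/
abbrev TauMon (n : ℕ) : Type := Option (Fin n) →₀ ℕ

/-- Abstract `τ`-polynomials: formal sums of distinct monomials, all with coefficient `1`. -/
abbrev TauAPol (n : ℕ) : Type := Finset (TauMon n)

/-- Abstract `τ`-multi-polynomials. -/
abbrev TauAMPol (n : ℕ) : Type := Fin n → TauAPol n

/-- The abstraction `α`: every non-zero coefficient is replaced by `1`. -/
def abstraction {n : ℕ} (p : TauMPol n) : TauAMPol n :=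
  fun i => (p i).support

/-- The canonical concretization `γ`: an abstract polynomial is read as an ordinary one. -/
def concretization {n : ℕ} (a : TauAMPol n) : TauMPol n :=
  fun i => ∑ m ∈ a i, MvPolynomial.monomial m 1

namespace TauAMPol

variable {n : ℕ}

/-- The identity transition `x_i' = x_i`. -/
protected def id : TauAMPol n :=
  fun i => {Finsupp.single (some i) 1}

/-- Abstract composition: `q ⊚ p = α(γ(q) ∘ γ(p))`. -/
def acomp (q p : TauAMPol n) : TauAMPol n :=
  abstraction (TauMPol.comp (concretization q) (concretization p))

/-- Idempotence with respect to abstract composition. -/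
def IsIdempotent (p : TauAMPol n) : Prop := acomp p p = p

/-- The set of `i` such that `x_i` is self-dependent in `p`, i.e. `x_i` occurs in `p i`. -/
def selfDep (p : TauAMPol n) : Set (Fin n) :=
  {i | ∃ m ∈ p i, m (some i) ≠ 0}

/-- A monomial is self-dependent in `p` if all the (program) variables in it are. -/
def IsSelfDepMon (p : TauAMPol n) (m : TauMon n) : Prop :=
  ∀ j : Fin n, m (some j) ≠ 0 → j ∈ selfDep p

open Classical in
/-- The sum `τ p[i]'`: the self-dependent monomials of `p i`, other than `x_i`, with a positive
degree in `τ`. -/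
def tauPart (p : TauAMPol n) (i : Fin n) : TauAPol n :=
  (p i).filter fun m => m ≠ Finsupp.single (some i) 1 ∧ IsSelfDepMon p m ∧ m none ≠ 0

open Classical in
/-- The sum `p[i]''`: the self-dependent monomials of `p i`, other than `x_i`, without `τ`. -/
def freePart (p : TauAMPol n) (i : Fin n) : TauAPol n :=
  (p i).filter fun m => m ≠ Finsupp.single (some i) 1 ∧ IsSelfDepMon p m ∧ m none = 0

open Classical in
/-- The sum `p[i]'''`: the monomials of `p i` that are not self-dependent. -/
def restPart (p : TauAMPol n) (i : Fin n) : TauAPol n :=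
  (p i).filter fun m => ¬ IsSelfDepMon p m

open Classical in
/-- Generalization: `p^τ[i] = x_i + τ p[i]' + τ p[i]'' + p[i]'''` if `x_i` is self-dependent, and
`p^τ[i] = p[i]` otherwise. Addition of abstract polynomials is the union of their monomials. -/
def generalize (p : TauAMPol n) : TauAMPol n :=
  fun i =>
    if i ∈ selfDep p then
      {Finsupp.single (some i) 1} ∪ tauPart p i
        ∪ (freePart p i).image (fun m => m + Finsupp.single none 1) ∪ restPart p i
    else p i

/-- Iterated composition of a set of abstract multi-polynomials. -/
def iter (T : Set (TauAMPol n)) : ℕ → Set (TauAMPol n)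
  | 0 => {TauAMPol.id}
  | k + 1 => iter T k ∪ {r | ∃ q ∈ T, ∃ p ∈ iter T k, r = acomp q p}

/-- Abstract closure. -/
def closure (T : Set (TauAMPol n)) : Set (TauAMPol n) := ⋃ k, iter T k

end TauAMPol

/-! ## The algorithm -/

/-- One round of the algorithm: closure, followed by the generalization of all idempotents. -/
def round {n : ℕ} (T : Set (TauAMPol n)) : Set (TauAMPol n) :=
  TauAMPol.closure T ∪
    {r | ∃ p ∈ TauAMPol.closure T, TauAMPol.IsIdempotent p ∧ r = TauAMPol.generalize p}

/-- The initial set `α(S)`. -/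
def start {n : ℕ} (S : Finset (MPol n)) : Set (TauAMPol n) :=
  {a | ∃ p ∈ S, a = abstraction p.toTau}

/-- The algorithm, started on `S`, stops and returns the finite set `A`: after some number of
rounds it has reached `A`, and a further round does not change `A`. -/
def Returns {n : ℕ} (S : Finset (MPol n)) (A : Finset (TauAMPol n)) : Prop :=
  (∃ k : ℕ, round^[k] (start S) = (A : Set (TauAMPol n))) ∧
    round (A : Set (TauAMPol n)) = (A : Set (TauAMPol n))

/-- The returned set is unique, so that one may speak of *the* set returned for `S`. -/
theorem Returns.unique {n : ℕ} {S : Finset (MPol n)} {A A' : Finset (TauAMPol n)}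
    (h : Returns S A) (h' : Returns S A') : A = A' := by
  have key : ∀ {B C : Finset (TauAMPol n)} {k l : ℕ}, k ≤ l →
      round^[k] (start S) = (B : Set (TauAMPol n)) →
      round (B : Set (TauAMPol n)) = (B : Set (TauAMPol n)) →
      round^[l] (start S) = (C : Set (TauAMPol n)) → B = C := by
    intro B C k l hkl hB hfix hC
    obtain ⟨d, rfl⟩ := Nat.exists_eq_add_of_le hkl
    rw [Nat.add_comm, Function.iterate_add_apply, hB, Function.iterate_fixed hfix] at hC
    exact_mod_cast hC
  obtain ⟨⟨k, hk⟩, hf⟩ := h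
  obtain ⟨⟨l, hl⟩, hf'⟩ := h'
  rcases le_total k l with hkl | hkl
  · exact key hkl hk hf hl
  · exact (key hkl hl hf' hk).symm

/-! ## Traces and bounds -/

/-- Traces over `S`: finite sequences of elements of `S`, the first transition first. -/
def IsTrace {n : ℕ} (S : Finset (MPol n)) (σ : List (MPol n)) : Prop :=
  ∀ p ∈ σ, p ∈ S

/-- The final state of the trace `σ` when it is started in the state `x`. -/
def run {n : ℕ} (σ : List (MPol n)) (x : Fin n → ℕ) : Fin n → ℕ :=
  σ.foldl (fun s p => fun i => MvPolynomial.eval s (p i)) x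

/-- The weight of a trace: its number of transitions. -/
def weight {n : ℕ} (σ : List (MPol n)) : ℕ := σ.length

/-- `p` bounds variable `j` in `σ`: the final value of `x_j` is at most `p(x, t)`, for every initial
state `x` and every `t` that is at least the weight of `σ`. -/
def BoundsVar {n : ℕ} (p : TauPol n) (σ : List (MPol n)) (j : Fin n) : Prop :=
  ∀ (x : Fin n → ℕ) (t : ℕ), weight σ ≤ t → run σ x j ≤ p.value x t

/-- `p` bounds the trace `σ`: it bounds all variables. -/
def Bounds {n : ℕ} (p : TauMPol n) (σ : List (MPol n)) : Prop :=
  ∀ j : Fin n, BoundsVar (p j) σ j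

/-- A loop is polynomially bounded if the final value of every variable is bounded, over all
traces, by one polynomial in the initial values and the number of iterations. -/
def IsPolynomiallyBounded {n : ℕ} (S : Finset (MPol n)) : Prop :=
  ∀ j : Fin n, ∃ p : TauPol n, ∀ σ : List (MPol n), IsTrace S σ →
    ∀ x : Fin n → ℕ, run σ x j ≤ p.value x (weight σ)

end

end SDL

namespace SDL

noncomputable section

/-! ## Factorization forests, in the form of a closure property of families of languages -/

section Factorization

variable {α M : Type*} [Monoid M]

open Computability

/-! Polynomial boundedness enters through lower bounds. Every abstract tuple built by the algorithm
is `Realizable`: traces of weight linear in `t + 1` reach at least its values at `τ = t`.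
Composition concatenates such traces, and generalization repeats those of an idempotent
(`AGood.generalize`). A realizable tuple without constant components that doubles a variable could
be iterated and would give exponential growth (`Realizable.not_doubling`). So a self-dependent `x_i`
occurs in its own component only as the monomial `x_i`, and under an idempotent dependence relation
two distinct variables never depend on each other (`Adm.antisymm`). Comparing degrees leaves only
finitely many realizable abstract tuples (`finite_setOf_aGood`), so the increasing rounds stop.

For the upper bounds, a trace is mapped to its dependence relation, an element of the finite monoid
`Dep n`. By Simon's factorization forest theorem, in the form `IsFactorizationClosed.kstar`, it
suffices that the languages with finitely many admissible bounds are closed under subsets, unions,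
products, and the star of a language with one idempotent relation `e`. Only the star is hard
(`exists_bounds_of_idempotent`). Variables that are not self-dependent are determined by
self-dependent ones through at most `n` steps, so only the latter need tracking. In one step a
self-dependent `x_i` grows by at most a constant times a sum of monomials in self-dependent
variables strictly below `x_i`. Some idempotent `g ∈ A` contains all these monomials, and
`g.generalize` adds up the increments over all steps, constants being absorbed by rescaling `τ`.
Composing it `n + 1` times serves all levels of the order; the first and last `n` transitions are
kept as they are.

The concrete bounds have large coefficients and need not be realizable, yet the coefficient of a
self-dependent `x_i` in its own component must stay `1`. The invariant `Good` ensures this: every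
single coefficient that is at least `2` can be realized with value `2`. That composition preserves
it rests on `two_le_eval`. -/

/-- A family of languages that is closed under subsets, finite unions, products, and the star of
languages all of whose words have the same idempotent value. -/
structure IsFactorizationClosed (φ : List α → M) (P : Language α → Prop) : Prop where
  mono : ∀ {K L : Language α}, K ≤ L → P L → P K
  one : P 1
  add : ∀ {K L : Language α}, P K → P L → P (K + L)
  mul : ∀ {K L : Language α}, P K → P L → P (K * L)
  star : ∀ {L : Language α} {e : M}, IsIdempotentElem e → (∀ w ∈ L, φ w = e) → P L → P (L∗)

/-- Nonempty products of words of `L` that lead from the state `p` to the state `q` and pass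
through states of `Q` in between; the states are the elements of `M`, and words act on the right. -/
inductive Path (φ : List α → M) (L : Language α) (Q : Set M) : M → M → List α → Prop
  | single {p : M} {l : List α} : l ∈ L → Path φ L Q p (p * φ l) l
  | cons {p q : M} {l w : List α} : l ∈ L → p * φ l ∈ Q → Path φ L Q (p * φ l) q w →
      Path φ L Q p q (l ++ w)

/-- The language of all words that label a path. -/
def pathLang (φ : List α → M) (L : Language α) (Q : Set M) (p q : M) : Language α :=
  {w | Path φ L Q p q w}

theorem add_kstar_le (a b : Language α) : (a + b)∗ ≤ b∗ * (a * b∗)∗ := by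
  apply kstar_le_of_mul_le_right
  · calc (1 : Language α) = 1 * 1 := (one_mul 1).symm
      _ ≤ b∗ * (a * b∗)∗ := mul_le_mul' one_le_kstar one_le_kstar
  · rw [add_mul]
    apply add_le
    · calc a * (b∗ * (a * b∗)∗) = (a * b∗) * (a * b∗)∗ := by rw [mul_assoc]
        _ ≤ (a * b∗)∗ := mul_kstar_le_kstar
        _ = 1 * (a * b∗)∗ := (one_mul _).symm
        _ ≤ _ := mul_le_mul' one_le_kstar le_rfl
    · rw [← mul_assoc]
      exact mul_le_mul' mul_kstar_le_kstar le_rfl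

variable {φ : List α → M} {P : Language α → Prop} {L : Language α}

theorem Path.eq_mul (happ : ∀ u v, φ (u ++ v) = φ u * φ v) {Q : Set M} {p q : M}
    {w : List α} (h : Path φ L Q p q w) : q = p * φ w := by
  induction h with
  | single => rfl
  | cons _ _ _ ih => rw [happ, ← mul_assoc]; exact ih

theorem Path.map_mem (happ : ∀ u v, φ (u ++ v) = φ u * φ v) {N : Submonoid M}
    (hL : ∀ w ∈ L, φ w ∈ N) {Q : Set M} {p q : M} {w : List α} (h : Path φ L Q p q w) :
    φ w ∈ N := by
  induction h with
  | single hl => exact hL _ hl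
  | cons hl _ _ ih => rw [happ]; exact N.mul_mem (hL _ hl) ih

theorem pathLang_empty_le (p q : M) : pathLang φ L ∅ p q ≤ L := by
  intro w hw
  cases hw with
  | single h => exact h
  | cons _ h _ => exact h.elim

/-- Kleene's decomposition: a path is cut at its visits to the new state `r`. -/
theorem pathLang_insert_le (Q : Set M) (r p q : M) :
    pathLang φ L (insert r Q) p q ≤
      pathLang φ L Q p q + pathLang φ L Q p r * ((pathLang φ L Q r r)∗ * pathLang φ L Q r q) := by
  intro w hw
  induction hw with
  | single h => exact Or.inl (Path.single h)
  | @cons p q l w hl hr _ ih =>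
    rcases ih with ih | ⟨u, hu, v, hv, huv⟩
    · rcases hr with hr | hr
      · refine Or.inr ⟨l, ?_, w, ⟨[], Language.nil_mem_kstar _, w, ?_, rfl⟩, rfl⟩
        · rw [← hr]; exact Path.single hl
        · rw [← hr]; exact ih
      · exact Or.inl (Path.cons hl hr ih)
    · rcases hr with hr | hr
      · refine Or.inr ⟨l, ?_, w, ?_, rfl⟩
        · rw [← hr]; exact Path.single hl
        · rw [hr] at hu
          obtain ⟨s, hs, x, hx, hsx⟩ := hv
          refine ⟨u ++ s, ?_, x, hx, ?_⟩
          · exact (mul_kstar_le_kstar (a := pathLang φ L Q r r)) ⟨u, hu, s, hs, rfl⟩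
          · simpa [List.append_assoc] using (congrArg (u ++ ·) hsx).trans huv
      · refine Or.inr ⟨l ++ u, Path.cons hl hr hu, v, hv, ?_⟩
        simpa [List.append_assoc] using congrArg (l ++ ·) huv

namespace IsFactorizationClosed

theorem zero (hP : IsFactorizationClosed φ P) : P 0 := hP.mono bot_le hP.one

theorem sum (hP : IsFactorizationClosed φ P) {ι : Type*} (s : Finset ι) (K : ι → Language α)
    (hK : ∀ i ∈ s, P (K i)) : P (∑ i ∈ s, K i) := by
  classical
  induction s using Finset.induction_on with
  | empty => simpa using hP.zero
  | insert i s hi ih =>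
    rw [Finset.sum_insert hi]
    exact hP.add (hK i (by simp)) (ih fun j hj => hK j (by simp [hj]))

theorem path (hP : IsFactorizationClosed φ P)
    (happ : ∀ u v, φ (u ++ v) = φ u * φ v) {N : Submonoid M} (hL : ∀ w ∈ L, φ w ∈ N) (hPL : P L)
    {Q : Set M} (hQ : Q.Finite)
    (ih : ∀ r ∈ Q, ∀ K : Language α, P K → (∀ w ∈ K, φ w ∈ N ∧ r * φ w = r) → P (K∗)) :
    ∀ p q, P (pathLang φ L Q p q) := by
  induction Q, hQ using Set.Finite.induction_on with
  | empty => exact fun p q => hP.mono (pathLang_empty_le p q) hPL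
  | @insert r Q _ _ ihQ =>
    intro p q
    have h := ihQ fun r hr => ih r (Set.mem_insert_of_mem _ hr)
    refine hP.mono (pathLang_insert_le Q r p q)
      (hP.add (h _ _) (hP.mul (h _ _) (hP.mul (ih r (Set.mem_insert _ _) _ (h _ _) ?_) (h _ _))))
    exact fun w hw => ⟨Path.map_mem happ hL hw, (Path.eq_mul happ hw).symm⟩

/-- Remove one value `x` at a time: if `A` holds the words of value `x` and `B` the others, then `(A
+ B)∗ ≤ B∗ * (A * B∗)∗`. All words of `A * B∗` have the value `x`, which is idempotent as a left
zero, so the closure under idempotent stars applies. -/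
theorem star_of_leftZero (hP : IsFactorizationClosed φ P) (hnil : φ [] = 1)
    (happ : ∀ u v, φ (u ++ v) = φ u * φ v) {N : Submonoid M} {Z : Set M} (hZ : Z.Finite)
    (hZN : Z ⊆ N) (hz : ∀ z ∈ Z, ∀ s ∈ N, z * s = z) :
    ∀ K : Language α, P K → (∀ w ∈ K, φ w ∈ Z) → P (K∗) := by
  induction Z, hZ using Set.Finite.induction_on with
  | empty =>
    intro K _ h
    have : K = 0 := by
      ext w
      exact ⟨fun hw => (h w hw).elim, fun hw => hw.elim⟩
    rw [this, kstar_zero]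
    exact hP.one
  | @insert x Z _ _ ih =>
    intro K hK h
    have hxN : x ∈ N := hZN (Set.mem_insert _ _)
    have hN : ∀ w ∈ K∗, φ w ∈ N := by
      rintro w ⟨ws, rfl, hws⟩
      induction ws with
      | nil => simp [hnil]
      | cons u us ihu =>
        rw [List.flatten_cons, happ]
        exact N.mul_mem (hZN (h u (hws u (by simp)))) (ihu fun y hy => hws y (by simp [hy]))
    let A : Language α := {w | w ∈ K ∧ φ w = x}
    let B : Language α := {w | w ∈ K ∧ φ w ∈ Z}
    have hAK : A ≤ K := fun w hw => hw.1
    have hBK : B ≤ K := fun w hw => hw.1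
    have hB : P (B∗) := by
      refine ih (fun z hz' => hZN (Set.mem_insert_of_mem _ hz'))
        (fun z hz' => hz z (Set.mem_insert_of_mem _ hz')) B (hP.mono hBK hK) fun w hw => hw.2
    have hKAB : K ≤ A + B := by
      intro w hw
      rcases h w hw with h' | h'
      · exact Or.inl ⟨hw, h'⟩
      · exact Or.inr ⟨hw, h'⟩
    refine hP.mono ((kstar_mono hKAB).trans (add_kstar_le A B)) (hP.mul hB (hP.star (e := x) ?_ ?_
      (hP.mul (hP.mono hAK hK) hB)))
    · exact hz x (Set.mem_insert _ _) x hxN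
    · rintro w ⟨u, hu, v, hv, rfl⟩
      have hv' : φ v ∈ N := hN v (kstar_mono hBK hv)
      change φ (u ++ v) = x
      rw [happ, hu.2, hz x (Set.mem_insert _ _) _ hv']

/-- Read the factors from state `1`, cut as soon as the state lies in `Z`, and restart at `1`. The
complete blocks have values in `Z`; the last block may be empty or unfinished. -/
theorem kstar_le_paths {N : Set M} {Z : Set M}
    (hN : N.Finite) (hL : ∀ p ∈ N, ∀ w ∈ L, p * φ w ∈ N) (h1 : (1 : M) ∈ N) :
    L∗ ≤ (∑ q ∈ hN.toFinset, {w | w ∈ pathLang φ L (N \ Z) 1 q ∧ q ∈ Z} : Language α)∗ *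
      (1 + ∑ q ∈ hN.toFinset, pathLang φ L (N \ Z) 1 q) := by
  classical
  have mem_sum : ∀ (K : M → Language α) (s : Finset M) (q : M) (w : List α), q ∈ s → w ∈ K q →
      w ∈ ∑ q ∈ s, K q := fun K s q w hq hw =>
    (Finset.single_le_sum (f := K) (fun _ _ => bot_le) hq) hw
  set K : Language α := ∑ q ∈ hN.toFinset, {w | w ∈ pathLang φ L (N \ Z) 1 q ∧ q ∈ Z} with hK
  set U : Language α := 1 + ∑ q ∈ hN.toFinset, pathLang φ L (N \ Z) 1 q with hU
  -- The induction removes factors from the left, so the unfinished first block has to be described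
  -- for every starting state `p`, not only for `1`.
  have key : ∀ ws : List (List α), (∀ y ∈ ws, y ∈ L) → ws.flatten ∈ K∗ * U ∧
      ∀ p ∈ N, ws.flatten = [] ∨ (∃ q ∈ N, Path φ L (N \ Z) p q ws.flatten) ∨
        ∃ q ∈ N, q ∈ Z ∧ ∃ u v, Path φ L (N \ Z) p q u ∧ v ∈ K∗ * U ∧ ws.flatten = u ++ v := by
    intro ws
    induction ws with
    | nil =>
      intro _
      refine ⟨⟨[], Language.nil_mem_kstar _, [], Or.inl rfl, rfl⟩, fun p _ => Or.inl rfl⟩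
    | cons l ws ih =>
      intro hws
      obtain ⟨ih1, ih2⟩ := ih fun y hy => hws y (by simp [hy])
      have hl : l ∈ L := hws l (by simp)
      have h2 : ∀ p ∈ N, (l :: ws).flatten = [] ∨
          (∃ q ∈ N, Path φ L (N \ Z) p q (l :: ws).flatten) ∨
          ∃ q ∈ N, q ∈ Z ∧ ∃ u v, Path φ L (N \ Z) p q u ∧ v ∈ K∗ * U ∧
            (l :: ws).flatten = u ++ v := by
        intro p hp
        have hp' : p * φ l ∈ N := hL p hp l hl
        by_cases hz : p * φ l ∈ Z
        · exact Or.inr (Or.inr ⟨_, hp', hz, l, ws.flatten, Path.single hl, ih1, by simp⟩)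
        · rcases ih2 _ hp' with h | ⟨q, hq, h⟩ | ⟨q, hq, hqZ, u, v, hu, hv, huv⟩
          · refine Or.inr (Or.inl ⟨_, hp', ?_⟩)
            rw [List.flatten_cons, h, List.append_nil]
            exact Path.single hl
          · exact Or.inr (Or.inl ⟨q, hq, by
              rw [List.flatten_cons]; exact Path.cons hl ⟨hp', hz⟩ h⟩)
          · refine Or.inr (Or.inr ⟨q, hq, hqZ, l ++ u, v, Path.cons hl ⟨hp', hz⟩ hu, hv, ?_⟩)
            rw [List.flatten_cons, huv, List.append_assoc]
      refine ⟨?_, h2⟩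
      rcases h2 1 h1 with h | ⟨q, hq, h⟩ | ⟨q, hq, hqZ, u, v, hu, hv, huv⟩
      · rw [h]
        exact ⟨[], Language.nil_mem_kstar _, [], Or.inl rfl, rfl⟩
      · refine ⟨[], Language.nil_mem_kstar _, _, Or.inr ?_, rfl⟩
        exact mem_sum _ _ q _ (hN.mem_toFinset.2 hq) h
      · rw [huv]
        have hu' : u ∈ K := mem_sum _ _ q u (hN.mem_toFinset.2 hq) ⟨hu, hqZ⟩
        have : u ++ v ∈ K * (K∗ * U) := ⟨u, hu', v, hv, rfl⟩
        rw [← mul_assoc] at this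
        exact (mul_le_mul' mul_kstar_le_kstar le_rfl : K * K∗ * U ≤ K∗ * U) this
  rintro w ⟨ws, rfl, hws⟩
  exact (key ws hws).1

/-- Induction on the submonoid `N`, with `Z` its left zeros. Loops at a state outside `Z` have
values in the stabilizer of that state, a smaller submonoid; the blocks that end in `Z` are covered
by `star_of_leftZero`. -/
theorem star_of_mem_submonoid [Finite M] (hP : IsFactorizationClosed φ P) (hnil : φ [] = 1)
    (happ : ∀ u v, φ (u ++ v) = φ u * φ v) (N : Submonoid M) :
    ∀ L : Language α, P L → (∀ w ∈ L, φ w ∈ N) → P (L∗) := by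
  induction N using WellFoundedLT.induction with
  | ind N ih =>
    intro L hPL hL
    have hN : (N : Set M).Finite := Set.toFinite _
    let Z : Set M := {z | z ∈ N ∧ ∀ s ∈ N, z * s = z}
    have hpath : ∀ p q, P (pathLang φ L (N \ Z) p q) := by
      refine hP.path happ hL hPL (Set.toFinite _) fun r hr K hK hKr => ?_
      -- The stabilizer of `r` in `N`. It is proper because otherwise `r` would be a left zero of
      -- `N`.
      let N' : Submonoid M :=
        { carrier := {s | s ∈ N ∧ r * s = r}
          one_mem' := ⟨N.one_mem, mul_one r⟩
          mul_mem' := fun {a b} ha hb => ⟨N.mul_mem ha.1 hb.1, by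
            rw [← mul_assoc, ha.2, hb.2]⟩ }
      refine ih N' (lt_of_le_of_ne (fun s hs => hs.1) fun h => hr.2 ⟨hr.1, fun s hs => ?_⟩) K hK hKr
      rw [← h] at hs
      exact hs.2
    refine hP.mono (kstar_le_paths (Z := Z) hN
      (fun p hp w hw => N.mul_mem hp (hL w hw)) N.one_mem) (hP.mul ?_ (hP.add hP.one ?_))
    · refine hP.star_of_leftZero hnil happ (N := N) (Z := Z) (Set.toFinite _) (fun z hz => hz.1)
        (fun z hz => hz.2) _ (hP.sum _ _ fun q _ => hP.mono (fun w hw => hw.1) (hpath 1 q)) ?_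
      have : (∑ q ∈ hN.toFinset, {w | w ∈ pathLang φ L (N \ Z) 1 q ∧ q ∈ Z} : Language α) ≤
          {w | φ w ∈ Z} := by
        refine Finset.sum_induction _ (fun K : Language α => K ≤ {w | φ w ∈ Z})
          (fun a b ha hb => add_le ha hb) bot_le fun q _ w hw => ?_
        have h := Path.eq_mul happ hw.1
        rw [one_mul] at h
        change φ w ∈ Z
        rw [← h]
        exact hw.2
      exact fun w hw => this hw
    · exact hP.sum _ _ fun q _ => hpath 1 q

/-- Simon's factorization forest theorem, as a closure property. -/
theorem kstar [Finite M] (hP : IsFactorizationClosed φ P) (hnil : φ [] = 1)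
    (happ : ∀ u v, φ (u ++ v) = φ u * φ v) (hPL : P L) : P (L∗) :=
  hP.star_of_mem_submonoid hnil happ ⊤ L hPL fun _ _ => Submonoid.mem_top _

end IsFactorizationClosed

end Factorization


/-! ## Supports of polynomials with natural coefficients -/

section Support

open MvPolynomial

variable {σ τ : Type*}

/-- Natural coefficients cannot cancel, so supports behave exactly under sums and products. This is
what makes `abstraction` compatible with composition. -/
theorem mem_support_add_iff {f g : MvPolynomial σ ℕ} {m : σ →₀ ℕ} :
    m ∈ (f + g).support ↔ m ∈ f.support ∨ m ∈ g.support := by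
  simp only [mem_support_iff, coeff_add]
  omega

theorem add_mem_support_mul {f g : MvPolynomial σ ℕ} {a b : σ →₀ ℕ} (ha : a ∈ f.support)
    (hb : b ∈ g.support) : a + b ∈ (f * g).support := by
  classical
  rw [mem_support_iff] at ha hb ⊢
  rw [coeff_mul]
  have : coeff a f * coeff b g ≤
      ∑ x ∈ Finset.HasAntidiagonal.antidiagonal (a + b), coeff x.1 f * coeff x.2 g :=
    Finset.single_le_sum (f := fun x : (σ →₀ ℕ) × (σ →₀ ℕ) => coeff x.1 f * coeff x.2 g)
      (fun _ _ => Nat.zero_le _) (show (a, b) ∈ Finset.HasAntidiagonal.antidiagonal (a + b) by simp)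
  have h2 := Nat.mul_pos (Nat.pos_of_ne_zero ha) (Nat.pos_of_ne_zero hb)
  omega

theorem mem_support_mul_iff {f g : MvPolynomial σ ℕ} {m : σ →₀ ℕ} :
    m ∈ (f * g).support ↔ ∃ a ∈ f.support, ∃ b ∈ g.support, a + b = m := by
  classical
  constructor
  · intro h
    simpa [Finset.mem_add] using support_mul f g h
  · rintro ⟨a, ha, b, hb, rfl⟩
    exact add_mem_support_mul ha hb

theorem support_mul_mono {f f' g g' : MvPolynomial σ ℕ} (hf : f.support ⊆ f'.support)
    (hg : g.support ⊆ g'.support) : (f * g).support ⊆ (f' * g').support := by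
  intro m hm
  obtain ⟨a, ha, b, hb, rfl⟩ := mem_support_mul_iff.1 hm
  exact add_mem_support_mul (hf ha) (hg hb)

theorem nsmul_mem_support_pow {f : MvPolynomial σ ℕ} {a : σ →₀ ℕ} (ha : a ∈ f.support) (k : ℕ) :
    k • a ∈ (f ^ k).support := by
  induction k with
  | zero => simp
  | succ k ih => rw [pow_succ, succ_nsmul]; exact add_mem_support_mul ih ha

theorem sum_mem_support_prod {ι : Type*} (s : Finset ι) (f : ι → MvPolynomial σ ℕ)
    (a : ι → σ →₀ ℕ) (h : ∀ i ∈ s, a i ∈ (f i).support) :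
    ∑ i ∈ s, a i ∈ (∏ i ∈ s, f i).support := by
  classical
  induction s using Finset.induction_on with
  | empty => simp
  | insert i s hi ih =>
    rw [Finset.sum_insert hi, Finset.prod_insert hi]
    exact add_mem_support_mul (h i (by simp)) (ih fun j hj => h j (by simp [hj]))

theorem mem_support_sum_iff {ι : Type*} {s : Finset ι} {f : ι → MvPolynomial σ ℕ} {m : σ →₀ ℕ} :
    m ∈ (∑ i ∈ s, f i).support ↔ ∃ i ∈ s, m ∈ (f i).support := by
  simp only [mem_support_iff, coeff_sum, ne_eq, Finset.sum_eq_zero_iff]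
  push Not
  rfl

theorem bind₁_eq_sum (p : σ → MvPolynomial τ ℕ) (q : MvPolynomial σ ℕ) :
    bind₁ p q = ∑ m ∈ q.support, C (coeff m q) * ∏ o ∈ m.support, p o ^ m o := by
  conv_lhs => rw [as_sum q]
  rw [map_sum]
  exact Finset.sum_congr rfl fun m _ => bind₁_monomial _ _ _

theorem mem_support_bind₁_iff {p : σ → MvPolynomial τ ℕ} {q : MvPolynomial σ ℕ} {m : τ →₀ ℕ} :
    m ∈ (bind₁ p q).support ↔
      ∃ d ∈ q.support, m ∈ (∏ o ∈ d.support, p o ^ d o).support := by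
  rw [bind₁_eq_sum, mem_support_sum_iff]
  refine exists_congr fun d => and_congr_right fun hd => ?_
  rw [mem_support_iff] at hd
  rw [mem_support_iff, mem_support_iff, coeff_C_mul]
  simp [hd]

theorem support_pow_mono {f g : MvPolynomial σ ℕ} (h : f.support ⊆ g.support) (k : ℕ) :
    (f ^ k).support ⊆ (g ^ k).support := by
  induction k with
  | zero => simp
  | succ k ih => rw [pow_succ, pow_succ]; exact support_mul_mono ih h

theorem support_prod_mono {ι : Type*} (s : Finset ι) {f g : ι → MvPolynomial σ ℕ}
    (h : ∀ i ∈ s, (f i).support ⊆ (g i).support) :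
    (∏ i ∈ s, f i).support ⊆ (∏ i ∈ s, g i).support := by
  classical
  induction s using Finset.induction_on with
  | empty => simp
  | insert i s hi ih =>
    rw [Finset.prod_insert hi, Finset.prod_insert hi]
    exact support_mul_mono (h i (by simp)) (ih fun j hj => h j (by simp [hj]))

theorem support_bind₁_mono {p p' : σ → MvPolynomial τ ℕ} {q q' : MvPolynomial σ ℕ}
    (hp : ∀ o, (p o).support ⊆ (p' o).support) (hq : q.support ⊆ q'.support) :
    (bind₁ p q).support ⊆ (bind₁ p' q').support := by
  intro m hm
  obtain ⟨d, hd, h⟩ := mem_support_bind₁_iff.1 hm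
  exact mem_support_bind₁_iff.2 ⟨d, hq hd,
    support_prod_mono _ (fun o _ => support_pow_mono (hp o) _) h⟩

/-- Substituting one monomial of `p o` for every variable `o` of a monomial of `q` gives a monomial
of `bind₁ p q`. -/
theorem subst_mem_support_bind₁ {p : σ → MvPolynomial τ ℕ} {q : MvPolynomial σ ℕ} {d : σ →₀ ℕ}
    (hd : d ∈ q.support) (r : σ → τ →₀ ℕ) (hr : ∀ o ∈ d.support, r o ∈ (p o).support) :
    ∑ o ∈ d.support, d o • r o ∈ (bind₁ p q).support :=
  mem_support_bind₁_iff.2 ⟨d, hd,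
    sum_mem_support_prod _ _ _ fun o ho => nsmul_mem_support_pow (hr o ho) _⟩

/-- If a variable occurs in `bind₁ p q`, then it occurs in `p o` for some variable `o` of `q`. -/
theorem exists_of_mem_support_bind₁ {p : σ → MvPolynomial τ ℕ} {q : MvPolynomial σ ℕ} {m : τ →₀ ℕ}
    (hm : m ∈ (bind₁ p q).support) {v : τ} (hv : m v ≠ 0) :
    ∃ d ∈ q.support, ∃ o, d o ≠ 0 ∧ ∃ r ∈ (p o).support, r v ≠ 0 := by
  have hpow : ∀ (f : MvPolynomial τ ℕ) (k : ℕ) (m : τ →₀ ℕ), m ∈ (f ^ k).support → m v ≠ 0 →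
      ∃ r ∈ f.support, r v ≠ 0 := by
    intro f k
    induction k with
    | zero =>
      intro m hm hv
      classical
      rw [pow_zero, mem_support_iff, coeff_one] at hm
      have : m = 0 := by
        by_contra h
        exact hm (if_neg (Ne.symm h))
      simp [this] at hv
    | succ k ih =>
      intro m hm hv
      rw [pow_succ] at hm
      obtain ⟨a, ha, b, hb, rfl⟩ := mem_support_mul_iff.1 hm
      by_cases h : b v = 0
      · exact ih a ha (by simpa [h] using hv)
      · exact ⟨b, hb, h⟩
  have hprod : ∀ (s : Finset σ) (d : σ →₀ ℕ) (m : τ →₀ ℕ), m ∈ (∏ o ∈ s, p o ^ d o).support →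
      m v ≠ 0 → ∃ o ∈ s, ∃ r ∈ (p o).support, r v ≠ 0 := by
    classical
    intro s d
    induction s using Finset.induction_on with
    | empty =>
      intro m hm hv
      rw [Finset.prod_empty] at hm
      have := hpow 0 0 m (by simpa using hm) hv
      simp at this
    | insert i s hi ih =>
      intro m hm hv
      rw [Finset.prod_insert hi] at hm
      obtain ⟨a, ha, b, hb, rfl⟩ := mem_support_mul_iff.1 hm
      by_cases h : b v = 0
      · exact ⟨i, by simp, hpow _ _ a ha (by simpa [h] using hv)⟩
      · obtain ⟨o, ho, h'⟩ := ih b hb h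
        exact ⟨o, by simp [ho], h'⟩
  obtain ⟨d, hd, h⟩ := mem_support_bind₁_iff.1 hm
  obtain ⟨o, ho, h'⟩ := hprod _ _ _ h hv
  exact ⟨d, hd, o, by simpa using ho, h'⟩

end Support

/-! ## Values -/

variable {n : ℕ}

/-- The value of a monomial. -/
def monVal (m : TauMon n) (x : Fin n → ℕ) (t : ℕ) : ℕ :=
  m.prod fun o k => (o.elim t x) ^ k

/-- The values of all components of a `τ`-multi-polynomial. -/
def TauMPol.val (p : TauMPol n) (x : Fin n → ℕ) (t : ℕ) : Fin n → ℕ := fun i => (p i).value x t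

theorem monVal_add (m m' : TauMon n) (x : Fin n → ℕ) (t : ℕ) :
    monVal (m + m') x t = monVal m x t * monVal m' x t := by
  classical
  unfold monVal
  exact Finsupp.prod_add_index' (fun _ => pow_zero _) (fun _ _ _ => pow_add _ _ _)

theorem monVal_single_some (i : Fin n) (x : Fin n → ℕ) (t : ℕ) :
    monVal (Finsupp.single (some i) 1) x t = x i := by simp [monVal]

theorem monVal_single_none (x : Fin n → ℕ) (t : ℕ) :
    monVal (Finsupp.single none 1 : TauMon n) x t = t := by simp [monVal]

theorem TauPol.value_monomial (m : TauMon n) (c : ℕ) (x : Fin n → ℕ) (t : ℕ) :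
    TauPol.value (MvPolynomial.monomial m c) x t = c * monVal m x t :=
  MvPolynomial.eval_monomial ..

theorem TauPol.value_add (p q : TauPol n) (x : Fin n → ℕ) (t : ℕ) :
    TauPol.value (p + q) x t = p.value x t + q.value x t := map_add _ _ _

theorem TauPol.value_sum {ι : Type*} (s : Finset ι) (p : ι → TauPol n) (x : Fin n → ℕ) (t : ℕ) :
    TauPol.value (∑ i ∈ s, p i) x t = ∑ i ∈ s, (p i).value x t := map_sum _ _ _

theorem TauPol.value_eq_sum (p : TauPol n) (x : Fin n → ℕ) (t : ℕ) :
    p.value x t = ∑ m ∈ p.support, p.coeff m * monVal m x t := by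
  conv_lhs => rw [MvPolynomial.as_sum p]
  rw [TauPol.value_sum]
  exact Finset.sum_congr rfl fun m _ => TauPol.value_monomial ..

theorem monVal_mono {m : TauMon n} {x y : Fin n → ℕ} {s t : ℕ}
    (h : ∀ j, m (some j) ≠ 0 → x j ≤ y j) (ht : s ≤ t) : monVal m x s ≤ monVal m y t := by
  unfold monVal
  refine Finset.prod_le_prod' fun o ho => ?_
  rw [Finsupp.mem_support_iff] at ho
  cases o with
  | none => exact Nat.pow_le_pow_left ht _
  | some j => exact Nat.pow_le_pow_left (h j ho) _

theorem TauPol.value_mono {p : TauPol n} {x y : Fin n → ℕ} {s t : ℕ}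
    (h : ∀ j, (∃ m ∈ p.support, m (some j) ≠ 0) → x j ≤ y j) (ht : s ≤ t) :
    p.value x s ≤ p.value y t := by
  rw [p.value_eq_sum, p.value_eq_sum]
  exact Finset.sum_le_sum fun m hm =>
    Nat.mul_le_mul_left _ (monVal_mono (fun j hj => h j ⟨m, hm, hj⟩) ht)

theorem TauMPol.val_mono (p : TauMPol n) {x y : Fin n → ℕ} {s t : ℕ} (h : x ≤ y) (ht : s ≤ t) :
    p.val x s ≤ p.val y t := fun _ => TauPol.value_mono (fun j _ => h j) ht

theorem TauPol.value_le_of_coeff_le {p q : TauPol n} (h : ∀ m, p.coeff m ≤ q.coeff m)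
    (x : Fin n → ℕ) (t : ℕ) : p.value x t ≤ q.value x t := by
  rw [p.value_eq_sum, q.value_eq_sum]
  calc ∑ m ∈ p.support, p.coeff m * monVal m x t
      ≤ ∑ m ∈ p.support, q.coeff m * monVal m x t :=
        Finset.sum_le_sum fun m _ => Nat.mul_le_mul_right _ (h m)
    _ ≤ _ := by
        refine Finset.sum_le_sum_of_subset fun m hm => ?_
        rw [MvPolynomial.mem_support_iff] at hm ⊢
        have := h m
        omega

theorem TauMPol.val_comp (q p : TauMPol n) (x : Fin n → ℕ) (t : ℕ) :
    (q.comp p).val x t = q.val (p.val x t) t := by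
  funext i
  unfold TauMPol.val TauMPol.comp TauPol.value
  rw [← MvPolynomial.coe_aeval_eq_eval, ← MvPolynomial.coe_aeval_eq_eval]
  change MvPolynomial.aeval _ _ = MvPolynomial.aeval _ _
  rw [MvPolynomial.aeval_bind₁]
  congr 2
  funext o
  cases o with
  | none => simp
  | some j => rfl

theorem monVal_pos {m : TauMon n} {x : Fin n → ℕ} {t : ℕ} (hx : ∀ j, 1 ≤ x j) (ht : 1 ≤ t) :
    1 ≤ monVal m x t := by
  unfold monVal
  refine Nat.one_le_iff_ne_zero.2 (Finset.prod_ne_zero_iff.2 fun o _ => pow_ne_zero _ ?_)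
  cases o with
  | none => exact Nat.one_le_iff_ne_zero.1 ht
  | some j => exact Nat.one_le_iff_ne_zero.1 (hx j)

theorem exists_add_single {σ : Type*} {m : σ →₀ ℕ} {o : σ} (h : m o ≠ 0) :
    ∃ m', m = Finsupp.single o 1 + m' := by
  classical
  exact ⟨m - Finsupp.single o 1, (add_tsub_cancel_of_le (Finsupp.single_le_iff.2 (by omega))).symm⟩

theorem le_monVal {m : TauMon n} {x : Fin n → ℕ} {t : ℕ} {k : Fin n} (hm : m (some k) ≠ 0)
    (hx : ∀ j, 1 ≤ x j) (ht : 1 ≤ t) : x k ≤ monVal m x t := by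
  obtain ⟨m', rfl⟩ := exists_add_single hm
  rw [monVal_add, monVal_single_some]
  exact Nat.le_mul_of_pos_right _ (monVal_pos hx ht)

theorem two_mul_le_monVal {m : TauMon n} {x : Fin n → ℕ} {t : ℕ} {k : Fin n}
    (hm : m (some k) ≠ 0) (hk : m ≠ Finsupp.single (some k) 1) (hx : ∀ j, 2 ≤ x j) (ht : 2 ≤ t) :
    2 * x k ≤ monVal m x t := by
  obtain ⟨m', rfl⟩ := exists_add_single hm
  have hm' : m' ≠ 0 := by rintro rfl; simp at hk
  obtain ⟨o, ho⟩ := Finsupp.ne_iff.1 hm'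
  obtain ⟨m'', rfl⟩ := exists_add_single ho
  rw [monVal_add, monVal_add, monVal_single_some, mul_comm 2]
  refine Nat.mul_le_mul_left _ ?_
  have h1 : 1 ≤ monVal m'' x t := monVal_pos (fun j => by have := hx j; omega) (by omega)
  have h2 : 2 ≤ monVal (Finsupp.single o 1 : TauMon n) x t := by
    cases o with
    | none => rw [monVal_single_none]; exact ht
    | some j => rw [monVal_single_some]; exact hx j
  calc 2 = 2 * 1 := rfl
    _ ≤ _ := Nat.mul_le_mul h2 h1

/-- Since `τ` divides the monomial, one factor `τ` absorbs the constant. All constants in the final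
bounds are disposed of in this way. -/
theorem mul_monVal_le {m : TauMon n} (hm : m none ≠ 0) (c : ℕ) (x : Fin n → ℕ) (t : ℕ) :
    c * monVal m x t ≤ monVal m x (c * t) := by
  rcases Nat.eq_zero_or_pos c with rfl | hc
  · simp
  · obtain ⟨m', rfl⟩ := exists_add_single hm
    rw [monVal_add, monVal_add, monVal_single_none, monVal_single_none, ← mul_assoc]
    refine Nat.mul_le_mul_left _ ?_
    exact monVal_mono (fun _ _ => le_rfl) (Nat.le_mul_of_pos_left _ hc)

theorem monVal_add_le {m : TauMon n} (hm : m none ≠ 0) (x : Fin n → ℕ) (s t : ℕ) :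
    monVal m x s + monVal m x t ≤ monVal m x (s + t) := by
  obtain ⟨m', rfl⟩ := exists_add_single hm
  simp only [monVal_add, monVal_single_none]
  rw [add_mul]
  exact Nat.add_le_add
    (Nat.mul_le_mul_left _ (monVal_mono (fun _ _ => le_rfl) (Nat.le_add_right _ _)))
    (Nat.mul_le_mul_left _ (monVal_mono (fun _ _ => le_rfl) (Nat.le_add_left _ _)))

theorem monVal_eq_of_tau_free {m : TauMon n} (hm : m none = 0) (x : Fin n → ℕ) (s t : ℕ) :
    monVal m x s = monVal m x t := by
  unfold monVal
  refine Finset.prod_congr rfl fun o ho => ?_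
  cases o with
  | none => exact absurd hm (Finsupp.mem_support_iff.1 ho)
  | some j => rfl

/-! ## Abstraction and concretization -/

theorem coeff_concretization (a : TauAMPol n) (i : Fin n) (m : TauMon n) [Decidable (m ∈ a i)] :
    (concretization a i).coeff m = if m ∈ a i then 1 else 0 := by
  classical
  simp only [concretization, MvPolynomial.coeff_sum, MvPolynomial.coeff_monomial]
  rw [Finset.sum_ite_eq' (a i) m]
  split_ifs <;> rfl

theorem abstraction_concretization (a : TauAMPol n) : abstraction (concretization a) = a := by
  classical
  funext i
  ext m
  rw [abstraction, MvPolynomial.mem_support_iff, coeff_concretization]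
  simp

theorem value_concretization (a : TauAMPol n) (x : Fin n → ℕ) (t : ℕ) (i : Fin n) :
    (concretization a).val x t i = ∑ m ∈ a i, monVal m x t := by
  unfold TauMPol.val concretization
  rw [TauPol.value_sum]
  exact Finset.sum_congr rfl fun m _ => by rw [TauPol.value_monomial, one_mul]

theorem coeff_concretization_abstraction_le (p : TauMPol n) (i : Fin n) (m : TauMon n) :
    (concretization (abstraction p) i).coeff m ≤ (p i).coeff m := by
  classical
  rw [coeff_concretization]
  split_ifs with h
  · exact Nat.one_le_iff_ne_zero.2 (MvPolynomial.mem_support_iff.1 h)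
  · exact Nat.zero_le _

theorem val_concretization_abstraction_le (p : TauMPol n) (x : Fin n → ℕ) (t : ℕ) :
    (concretization (abstraction p)).val x t ≤ p.val x t := fun i =>
  TauPol.value_le_of_coeff_le (coeff_concretization_abstraction_le p i) x t

theorem abstraction_comp_mono {q q' p p' : TauMPol n}
    (hq : ∀ i, abstraction q i ⊆ abstraction q' i) (hp : ∀ i, abstraction p i ⊆ abstraction p' i)
    (i : Fin n) : abstraction (q.comp p) i ⊆ abstraction (q'.comp p') i := by
  refine support_bind₁_mono (fun o => ?_) (hq i)
  cases o with
  | none => exact subset_rfl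
  | some j => exact hp j

theorem abstraction_comp_congr {q q' p p' : TauMPol n} (hq : abstraction q = abstraction q')
    (hp : abstraction p = abstraction p') : abstraction (q.comp p) = abstraction (q'.comp p') := by
  funext i
  refine subset_antisymm (abstraction_comp_mono ?_ ?_ i) (abstraction_comp_mono ?_ ?_ i) <;>
    intro j <;> simp [hq, hp]

theorem abstraction_comp (q p : TauMPol n) :
    abstraction (q.comp p) = TauAMPol.acomp (abstraction q) (abstraction p) :=
  abstraction_comp_congr (abstraction_concretization _).symm (abstraction_concretization _).symm

/-- The identity transition. -/
def TauMPol.one : TauMPol n := fun i => MvPolynomial.X (some i)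

theorem TauMPol.comp_one (p : TauMPol n) : p.comp TauMPol.one = p := by
  funext i
  have : (fun o : Option (Fin n) => o.elim (MvPolynomial.X none) (TauMPol.one (n := n))) =
      (MvPolynomial.X : Option (Fin n) → TauPol n) := by
    funext o
    cases o <;> rfl
  unfold TauMPol.comp
  rw [this, MvPolynomial.bind₁_X_left]
  rfl

theorem TauMPol.one_comp (p : TauMPol n) : TauMPol.one.comp p = p := by
  funext i
  exact MvPolynomial.bind₁_X_right _ _

theorem TauMPol.comp_assoc (r q p : TauMPol n) : (r.comp q).comp p = r.comp (q.comp p) := by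
  funext i
  unfold TauMPol.comp
  rw [MvPolynomial.bind₁_bind₁]
  congr 2
  funext o
  cases o with
  | none => exact MvPolynomial.bind₁_X_right _ _
  | some j => rfl

theorem concretization_id : concretization (TauAMPol.id (n := n)) = TauMPol.one := by
  funext i
  simp [concretization, TauAMPol.id, TauMPol.one, MvPolynomial.X]

theorem abstraction_one : abstraction (TauMPol.one (n := n)) = TauAMPol.id := by
  rw [← concretization_id, abstraction_concretization]

theorem acomp_id (a : TauAMPol n) : a.acomp TauAMPol.id = a := by
  rw [TauAMPol.acomp, concretization_id, TauMPol.comp_one, abstraction_concretization]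

theorem acomp_assoc (r q p : TauAMPol n) : (r.acomp q).acomp p = r.acomp (q.acomp p) := by
  rw [← abstraction_concretization r, ← abstraction_concretization q,
    ← abstraction_concretization p]
  simp only [← abstraction_comp, TauMPol.comp_assoc]

/-- Substituting one monomial for every variable of a monomial of `q`. -/
theorem subst_mem_acomp {q p : TauAMPol n} {i : Fin n} {d : TauMon n} (hd : d ∈ q i)
    (r : Fin n → TauMon n) (hr : ∀ j, d (some j) ≠ 0 → r j ∈ p j) :
    ∑ o ∈ d.support, d o • (o.elim (Finsupp.single none 1) r : TauMon n) ∈ q.acomp p i := by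
  refine subst_mem_support_bind₁ (q := concretization q i) ?_ _ ?_
  · have := congrFun (abstraction_concretization q) i
    rw [abstraction] at this
    rwa [this]
  · intro o ho
    cases o with
    | none => simp [MvPolynomial.support_X]
    | some j =>
      have := congrFun (abstraction_concretization p) j
      rw [abstraction] at this
      change r j ∈ (concretization p j).support
      rw [this]
      exact hr j (Finsupp.mem_support_iff.1 ho)

theorem mem_acomp_of_single_left {q p : TauAMPol n} {i : Fin n} {m : TauMon n}
    (hq : Finsupp.single (some i) 1 ∈ q i) (hm : m ∈ p i) : m ∈ q.acomp p i := by
  have := subst_mem_acomp (p := p) hq (fun _ => m) fun j hj => by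
    have : j = i := by
      by_contra h
      exact hj (by simp [Ne.symm h])
    rwa [this]
  simpa [Finsupp.support_single] using this

theorem mem_acomp_of_single_right {q p : TauAMPol n} {i : Fin n} {m : TauMon n}
    (hm : m ∈ q i) (hp : ∀ j, m (some j) ≠ 0 → Finsupp.single (some j) 1 ∈ p j) :
    m ∈ q.acomp p i := by
  have := subst_mem_acomp hm (fun j => Finsupp.single (some j) 1) hp
  convert this using 1
  conv_lhs => rw [← Finsupp.sum_single m]
  refine Finset.sum_congr rfl fun o _ => ?_
  cases o <;> simp

/-! ## Dependence relations -/

/-- Relations on the variables, with composition as multiplication. -/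
def Dep (n : ℕ) : Type := Fin n → Fin n → Prop

@[ext] theorem Dep.ext {d e : Dep n} (h : ∀ i j, d i j ↔ e i j) : d = e :=
  funext fun i => funext fun j => propext (h i j)

instance : Finite (Dep n) := inferInstanceAs (Finite (Fin n → Fin n → Prop))

/-- In the product `d * e`, the relation `d` belongs to the transition that is executed first. -/
instance : Monoid (Dep n) where
  one := fun i j => i = j
  mul d e := fun i k => ∃ j, e i j ∧ d j k
  mul_assoc a b c := by
    ext i l
    exact ⟨fun ⟨j, h1, k, h2, h3⟩ => ⟨k, ⟨j, h1, h2⟩, h3⟩,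
      fun ⟨k, ⟨j, h1, h2⟩, h3⟩ => ⟨j, h1, k, h2, h3⟩⟩
  one_mul a := by
    ext i l
    exact ⟨fun ⟨j, h1, h2⟩ => (show j = l from h2) ▸ h1, fun h => ⟨l, h, rfl⟩⟩
  mul_one a := by
    ext i l
    exact ⟨fun ⟨j, h1, h2⟩ => (show i = j from h1) ▸ h2, fun h => ⟨i, rfl, h⟩⟩

theorem Dep.mul_apply (d e : Dep n) (i k : Fin n) : (d * e) i k ↔ ∃ j, e i j ∧ d j k := Iff.rfl

theorem Dep.one_apply (i j : Fin n) : (1 : Dep n) i j ↔ i = j := Iff.rfl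

/-- `occ a i j` means that `x_j` occurs in `a i`. -/
def occ (a : TauAMPol n) : Dep n := fun i j => ∃ m ∈ a i, m (some j) ≠ 0

/-- No component is constant (in the program variables). -/
def Nonconst (a : TauAMPol n) : Prop := ∀ i, ∃ j, occ a i j

theorem occ_id : occ (TauAMPol.id (n := n)) = 1 := by
  ext i j
  simp only [occ, TauAMPol.id, Finset.mem_singleton, exists_eq_left, Dep.one_apply]
  rw [Finsupp.single_apply]
  simp

/-- Nonconstancy is needed because substituting an empty component would delete a monomial together
with its other variables. -/
theorem occ_acomp (q p : TauAMPol n) (hp : Nonconst p) : occ (q.acomp p) = occ p * occ q := by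
  classical
  ext i k
  rw [Dep.mul_apply]
  constructor
  · rintro ⟨m, hm, hk⟩
    obtain ⟨d, hd, o, ho, r, hr, hrk⟩ := exists_of_mem_support_bind₁ hm hk
    have h1 := congrFun (abstraction_concretization q) i
    rw [abstraction] at h1
    rw [h1] at hd
    cases o with
    | none => simp [MvPolynomial.support_X] at hr; simp [hr] at hrk
    | some j =>
      have h2 := congrFun (abstraction_concretization p) j
      rw [abstraction] at h2
      change r ∈ (concretization p j).support at hr
      rw [h2] at hr
      exact ⟨j, ⟨d, hd, ho⟩, ⟨r, hr, hrk⟩⟩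
  · rintro ⟨j, ⟨d, hd, hdj⟩, ⟨r, hr, hrk⟩⟩
    choose k' m' hm' _ using hp
    -- The monomial `r` with `x_k` is substituted for `x_j`, and any available monomial for the
    -- remaining variables.
    refine ⟨_, subst_mem_acomp hd (Function.update m' j r) ?_, ?_⟩
    · intro l _
      by_cases h : l = j
      · subst h; simpa using hr
      · simpa [h] using hm' l
    · rw [Finsupp.finsetSum_apply]
      refine (Finset.sum_pos' (fun _ _ => Nat.zero_le _)
        ⟨some j, Finsupp.mem_support_iff.2 hdj, ?_⟩).ne'
      simp only [Option.elim_some, Function.update_self, Finsupp.smul_apply, smul_eq_mul]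
      exact Nat.mul_pos (Nat.pos_of_ne_zero hdj) (Nat.pos_of_ne_zero hrk)

theorem Nonconst.acomp {q p : TauAMPol n} (hq : Nonconst q) (hp : Nonconst p) :
    Nonconst (q.acomp p) := by
  intro i
  obtain ⟨j, hj⟩ := hq i
  obtain ⟨k, hk⟩ := hp j
  exact ⟨k, by rw [occ_acomp q p hp]; exact ⟨j, hj, hk⟩⟩

theorem Nonconst.id : Nonconst (TauAMPol.id (n := n)) := fun i => ⟨i, by rw [occ_id]; rfl⟩


variable {n : ℕ}

/-! ## Runs -/

theorem run_append (σ ρ : List (MPol n)) (x : Fin n → ℕ) : run (σ ++ ρ) x = run ρ (run σ x) := by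
  simp [run, List.foldl_append]

theorem val_toTau (p : MPol n) (x : Fin n → ℕ) (t : ℕ) : p.toTau.val x t = run [p] x := by
  funext i
  unfold TauMPol.val TauPol.value MPol.toTau
  rw [MvPolynomial.eval_rename]
  rfl

theorem run_mono (σ : List (MPol n)) {x y : Fin n → ℕ} (h : x ≤ y) : run σ x ≤ run σ y := by
  induction σ generalizing x y with
  | nil => exact h
  | cons p σ ih =>
    rw [← List.singleton_append, run_append, run_append, ← val_toTau p x 0, ← val_toTau p y 0]
    exact ih (p.toTau.val_mono h le_rfl)

theorem run_flatten_replicate (σ : List (MPol n)) (k : ℕ) (x : Fin n → ℕ) :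
    run (List.replicate k σ).flatten x = (run σ)^[k] x := by
  induction k generalizing x with
  | zero => rfl
  | succ k ih =>
    rw [List.replicate_succ, List.flatten_cons, run_append, ih, Function.iterate_succ_apply]

theorem isTrace_append {S : Finset (MPol n)} {σ ρ : List (MPol n)} (hσ : IsTrace S σ)
    (hρ : IsTrace S ρ) : IsTrace S (σ ++ ρ) := fun p hp =>
  (List.mem_append.1 hp).elim (hσ p) (hρ p)

theorem isTrace_flatten_replicate {S : Finset (MPol n)} {σ : List (MPol n)} (hσ : IsTrace S σ)
    (k : ℕ) : IsTrace S (List.replicate k σ).flatten := by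
  intro p hp
  obtain ⟨l, hl, hp⟩ := List.mem_flatten.1 hp
  rw [List.eq_of_mem_replicate hl] at hp
  exact hσ p hp

theorem weight_append (σ ρ : List (MPol n)) : weight (σ ++ ρ) = weight σ + weight ρ :=
  List.length_append

theorem weight_flatten_replicate (σ : List (MPol n)) (k : ℕ) :
    weight (List.replicate k σ).flatten = k * weight σ := by
  simp [weight, List.length_flatten]

/-! ## Growth of polynomials -/

theorem monVal_le_pow {m : TauMon n} {x : Fin n → ℕ} {t Y : ℕ} (hx : ∀ j, x j ≤ Y) (ht : t ≤ Y) :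
    monVal m x t ≤ Y ^ m.degree := by
  rw [Finsupp.degree_apply, ← Finset.prod_pow_eq_pow_sum]
  refine Finset.prod_le_prod' fun o _ => Nat.pow_le_pow_left ?_ _
  cases o with
  | none => exact ht
  | some j => exact hx j

theorem monVal_const (m : TauMon n) (Y : ℕ) : monVal m (fun _ => Y) Y = Y ^ m.degree := by
  rw [Finsupp.degree_apply, ← Finset.prod_pow_eq_pow_sum]
  refine Finset.prod_congr rfl fun o _ => ?_
  cases o <;> rfl

theorem TauPol.exists_value_le_pow (p : TauPol n) : ∃ K d : ℕ, ∀ (x : Fin n → ℕ) (t Y : ℕ),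
    1 ≤ Y → (∀ j, x j ≤ Y) → t ≤ Y → p.value x t ≤ K * Y ^ d := by
  refine ⟨∑ m ∈ p.support, p.coeff m, p.support.sup Finsupp.degree, fun x t Y hY hx ht => ?_⟩
  rw [p.value_eq_sum, Finset.sum_mul]
  exact Finset.sum_le_sum fun m hm => Nat.mul_le_mul_left _ ((monVal_le_pow hx ht).trans
    (Nat.pow_le_pow_right hY (Finset.le_sup (f := Finsupp.degree) hm)))

theorem IsPolynomiallyBounded.exists_le_pow {S : Finset (MPol n)} (hS : IsPolynomiallyBounded S) :
    ∃ K d : ℕ, ∀ σ, IsTrace S σ → ∀ (x : Fin n → ℕ) (Y : ℕ), 1 ≤ Y → (∀ j, x j ≤ Y) →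
      weight σ ≤ Y → ∀ i, run σ x i ≤ K * Y ^ d := by
  choose P hP using hS
  choose K d h using fun i => (P i).exists_value_le_pow
  refine ⟨∑ i, K i, ∑ i, d i, fun σ hσ x Y hY hx hw i => (hP i σ hσ x).trans
    ((h i x _ Y hY hx hw).trans (Nat.mul_le_mul ?_ (Nat.pow_le_pow_right hY ?_)))⟩
  · exact Finset.single_le_sum (f := K) (fun _ _ => Nat.zero_le _) (Finset.mem_univ i)
  · exact Finset.single_le_sum (f := d) (fun _ _ => Nat.zero_le _) (Finset.mem_univ i)

theorem exists_pow_lt_two_pow (K d : ℕ) : ∃ k : ℕ, K * (k + 1) ^ d < 2 ^ k := by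
  have h := (isLittleO_pow_const_const_pow_of_one_lt (R := ℝ) d (one_lt_two)).def
    (c := 1 / (2 * (K + 1))) (by positivity)
  obtain ⟨N, hN⟩ := Filter.eventually_atTop.1 h
  refine ⟨N, ?_⟩
  have h1 := hN (N + 1) (Nat.le_succ N)
  rw [Real.norm_of_nonneg (by positivity), Real.norm_of_nonneg (by positivity)] at h1
  have hK : (0 : ℝ) < 2 * (K + 1) := by positivity
  rw [div_mul_eq_mul_div, one_mul, le_div_iff₀ hK, pow_succ (2 : ℝ)] at h1
  have h2 : (0 : ℝ) < ((N + 1 : ℕ) : ℝ) ^ d := by positivity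
  have h3 : (K : ℝ) * ((N + 1 : ℕ) : ℝ) ^ d < 2 ^ N := by nlinarith
  exact_mod_cast h3

/-! ## Realizable multi-polynomials -/

/-- The `τ`-multi-polynomial `F` is a lower bound for what traces of weight `O(τ)` achieve. -/
def Realizable (S : Finset (MPol n)) (F : TauMPol n) : Prop :=
  ∃ C : ℕ, ∀ t : ℕ, ∃ σ, IsTrace S σ ∧ weight σ ≤ C * (t + 1) ∧ ∀ x, F.val x t ≤ run σ x

variable {S : Finset (MPol n)}

theorem Realizable.mono {F F' : TauMPol n} (h : Realizable S F')
    (hle : ∀ x t, F.val x t ≤ F'.val x t) : Realizable S F := by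
  obtain ⟨C, hC⟩ := h
  refine ⟨C, fun t => ?_⟩
  obtain ⟨σ, h1, h2, h3⟩ := hC t
  exact ⟨σ, h1, h2, fun x => (hle x t).trans (h3 x)⟩

theorem Realizable.of_coeff_le {F F' : TauMPol n} (h : Realizable S F')
    (hle : ∀ i m, (F i).coeff m ≤ (F' i).coeff m) : Realizable S F :=
  h.mono fun x t i => TauPol.value_le_of_coeff_le (hle i) x t

theorem Realizable.comp {q p : TauMPol n} (hq : Realizable S q) (hp : Realizable S p) :
    Realizable S (q.comp p) := by
  obtain ⟨C, hC⟩ := hq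
  obtain ⟨D, hD⟩ := hp
  refine ⟨D + C, fun t => ?_⟩
  obtain ⟨σ, h1, h2, h3⟩ := hC t
  obtain ⟨ρ, h1', h2', h3'⟩ := hD t
  refine ⟨ρ ++ σ, isTrace_append h1' h1, ?_, fun x => ?_⟩
  · rw [weight_append, add_mul]
    exact Nat.add_le_add h2' h2
  · rw [TauMPol.val_comp, run_append]
    exact (h3 _).trans (run_mono σ (h3' x))

theorem Realizable.of_le_rescale {F F' : TauMPol n} (h : Realizable S F') (D : ℕ)
    (hle : ∀ x t, F.val x t ≤ F'.val x (D * t)) : Realizable S F := by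
  obtain ⟨C, hC⟩ := h
  refine ⟨C * (D + 1), fun t => ?_⟩
  obtain ⟨σ, h1, h2, h3⟩ := hC (D * t)
  refine ⟨σ, h1, h2.trans ?_, fun x => (hle x t).trans (h3 x)⟩
  rw [mul_assoc]
  exact Nat.mul_le_mul_left _ (by nlinarith)

theorem realizable_toTau {p : MPol n} (hp : p ∈ S) : Realizable S p.toTau :=
  ⟨1, fun t => ⟨[p], by simpa [IsTrace] using hp, by simp [weight], fun x => by
    rw [val_toTau]⟩⟩

theorem realizable_one : Realizable S TauMPol.one :=
  ⟨0, fun t => ⟨[], by simp [IsTrace], by simp [weight], fun x i => by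
    simp [TauMPol.val, TauMPol.one, TauPol.value, run]⟩⟩

/-- In a polynomially bounded loop no variable can be doubled repeatedly. -/
theorem Realizable.not_doubling (hS : IsPolynomiallyBounded S) {F : TauMPol n}
    (hF : Realizable S F) (h2 : ∀ y, (∀ j, 2 ≤ y j) → ∀ j, 2 ≤ F.val y 2 j) (i : Fin n)
    (hi : ∀ y, (∀ j, 2 ≤ y j) → 2 * y i ≤ F.val y 2 i) : False := by
  obtain ⟨C, hC⟩ := hF
  obtain ⟨σ, hσ, hw, hrun⟩ := hC 2
  obtain ⟨K, d, hK⟩ := hS.exists_le_pow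
  have key : ∀ k : ℕ, (∀ j, 2 ≤ (run σ)^[k] (fun _ => 2) j) ∧
      2 ^ k ≤ (run σ)^[k] (fun _ => 2) i := by
    intro k
    induction k with
    | zero => exact ⟨fun j => le_rfl, by simp⟩
    | succ k ih =>
      rw [Function.iterate_succ_apply']
      refine ⟨fun j => (h2 _ ih.1 j).trans (hrun _ j), ?_⟩
      calc 2 ^ (k + 1) = 2 * 2 ^ k := by ring
        _ ≤ 2 * (run σ)^[k] (fun _ => 2) i := Nat.mul_le_mul_left _ ih.2
        _ ≤ _ := (hi _ ih.1).trans (hrun _ i)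
  -- The trace `σ` has weight at most `3 * C`, so the initial values `2` and the weight of its
  -- `k`-fold repetition are at most `(3 * C + 2) * (k + 1)`.
  obtain ⟨k, hk⟩ := exists_pow_lt_two_pow (K * (C * 3 + 2) ^ d) d
  have h3 := (key k).2
  rw [← run_flatten_replicate] at h3
  have h4 := hK _ (isTrace_flatten_replicate hσ k) (fun _ => 2) ((C * 3 + 2) * (k + 1))
    (by nlinarith) (fun _ => by nlinarith) (by
      rw [weight_flatten_replicate]
      calc k * weight σ ≤ k * (C * 3) := Nat.mul_le_mul_left _ hw
        _ ≤ _ := by nlinarith) i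
  rw [mul_pow, ← mul_assoc] at h4
  omega

/-! ## Good abstract multi-polynomials -/

/-- Abstract multi-polynomials without constant components that are realized by traces. -/
def AGood (S : Finset (MPol n)) (a : TauAMPol n) : Prop :=
  Realizable S (concretization a) ∧ Nonconst a

theorem AGood.acomp {q p : TauAMPol n} (hq : AGood S q) (hp : AGood S p) :
    AGood S (q.acomp p) :=
  ⟨(hq.1.comp hp.1).mono fun x t => val_concretization_abstraction_le _ x t, hq.2.acomp hp.2⟩

theorem AGood.id : AGood S TauAMPol.id := ⟨by
  rw [concretization_id]; exact realizable_one, Nonconst.id⟩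

theorem AGood.toTau {p : MPol n} (hp : p ∈ S) (hv : ∀ i, (p i).vars.Nonempty) :
    AGood S (abstraction p.toTau) := by
  refine ⟨(realizable_toTau hp).mono fun x t => val_concretization_abstraction_le _ x t,
    fun i => ?_⟩
  obtain ⟨j, hj⟩ := hv i
  obtain ⟨m, hm, hmj⟩ := (MvPolynomial.mem_vars_iff_mem_support j).1 hj
  classical
  refine ⟨j, m.mapDomain some, ?_, ?_⟩
  · unfold abstraction MPol.toTau
    rw [MvPolynomial.support_rename_of_injective (Option.some_injective _)]
    exact Finset.mem_image_of_mem _ hm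
  · rw [Finsupp.mapDomain_apply (Option.some_injective _)]
    exact Finsupp.mem_support_iff.1 hmj

theorem two_le_val_concretization {a : TauAMPol n} (ha : Nonconst a) {y : Fin n → ℕ}
    (hy : ∀ j, 2 ≤ y j) {t : ℕ} (ht : 1 ≤ t) (i : Fin n) : 2 ≤ (concretization a).val y t i := by
  obtain ⟨j, m, hm, hmj⟩ := ha i
  rw [value_concretization]
  calc 2 ≤ y j := hy j
    _ ≤ monVal m y t := le_monVal hmj (fun k => by have := hy k; omega) ht
    _ ≤ _ := Finset.single_le_sum (f := fun m => monVal m y t) (fun _ _ => Nat.zero_le _) hm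

/-- A variable `x_i` that occurs in the `i`-th component occurs there only as the monomial `x_i`. -/
theorem AGood.eq_single (hS : IsPolynomiallyBounded S) {a : TauAMPol n} (ha : AGood S a)
    {i : Fin n} {m : TauMon n} (hm : m ∈ a i) (hi : m (some i) ≠ 0) :
    m = Finsupp.single (some i) 1 := by
  by_contra hne
  refine ha.1.not_doubling hS (fun y hy => two_le_val_concretization ha.2 hy (by norm_num)) i ?_
  intro y hy
  rw [value_concretization]
  exact (two_mul_le_monVal hi hne hy le_rfl).trans
    (Finset.single_le_sum (f := fun m => monVal m y 2) (fun _ _ => Nat.zero_le _) hm)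

/-- The exponent `d` of the growth bound is the same for all traces. A monomial of larger degree
would outgrow it along `x = t → ∞`, because realizing traces have weight linear in `t`. So all
degrees are at most `d`. -/
theorem finite_setOf_aGood (hS : IsPolynomiallyBounded S) : {a | AGood S a}.Finite := by
  obtain ⟨K, d, hK⟩ := hS.exists_le_pow
  have hdeg : ∀ a, AGood S a → ∀ i, ∀ m ∈ a i, m.degree ≤ d := by
    intro a ha i m hm
    obtain ⟨C, hC⟩ := ha.1
    by_contra hd
    -- At `x = t = L + 1` everything is at most `(2 * C + 1) * (L + 1)`, so the run is bounded by `L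
    -- * (L + 1) ^ d`, which is less than `(L + 1) ^ (d + 1)`.
    set L := K * (2 * C + 1) ^ d with hL
    obtain ⟨σ, hσ, hw, hrun⟩ := hC (L + 1)
    have h1 := hrun (fun _ => L + 1) i
    rw [value_concretization] at h1
    have h2 : monVal m (fun _ => L + 1) (L + 1) ≤ _ :=
      Finset.single_le_sum (f := fun m => monVal m (fun _ => L + 1) (L + 1))
        (fun _ _ => Nat.zero_le _) hm
    rw [monVal_const] at h2
    have h3 := hK σ hσ (fun _ => L + 1) ((2 * C + 1) * (L + 1)) (by nlinarith)
      (fun _ => by nlinarith) (hw.trans (by nlinarith)) i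
    rw [mul_pow, ← mul_assoc, ← hL] at h3
    have h4 : (L + 1) ^ (d + 1) ≤ (L + 1) ^ m.degree :=
      Nat.pow_le_pow_right (Nat.succ_pos L) (by omega)
    have h5 : (L + 1) ^ (d + 1) ≤ L * (L + 1) ^ d := h4.trans (h2.trans (h1.trans h3))
    rw [pow_succ, mul_comm] at h5
    have := Nat.le_of_mul_le_mul_right h5 (by positivity)
    omega
  have hmon : {m : TauMon n | m.degree ≤ d}.Finite := Finsupp.finite_of_degree_le d
  have hset : {s : TauAPol n | s ⊆ hmon.toFinset}.Finite :=
    (hmon.toFinset.powerset.finite_toSet).subset fun s hs => by simpa using hs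
  refine (Set.Finite.pi' fun _ : Fin n => hset).subset fun a ha i => ?_
  intro m hm
  simpa using hdeg a ha i m hm

/-! ## Elimination of variables that are not self-dependent -/

theorem Dep.trans_of_isIdempotentElem {e : Dep n} (he : IsIdempotentElem e) {i j k : Fin n}
    (hij : e i j) (hjk : e j k) : e i k := by
  rw [← he.eq]
  exact ⟨j, hij, hjk⟩

/-- Two runs of transitions with transitive dependence relation `e` that compare on the
self-dependent variables compare on all variables after `n` steps. -/
theorem Dep.le_of_le_selfDep {e : Dep n} (he : IsIdempotentElem e) (c u : ℕ → Fin n → ℕ)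
    (f : ℕ → (Fin n → ℕ) → Fin n → ℕ)
    (hf : ∀ s < n, ∀ a b i, (∀ j, e i j → a j ≤ b j) → f s a i ≤ f s b i)
    (hc : ∀ s < n, c (s + 1) ≤ f s (c s)) (hu : ∀ s < n, f s (u s) ≤ u (s + 1))
    (hcu : ∀ s ≤ n, ∀ i, e i i → c s i ≤ u s i) : c n ≤ u n := by
  classical
  -- The rank counts the variables below `i` that are not self-dependent. It drops strictly along
  -- dependences among such variables, and after `s` steps those of rank below `s` are settled.
  let rank : Fin n → ℕ := fun i => (Finset.univ.filter fun k => e i k ∧ ¬ e k k).card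
  have key : ∀ s ≤ n, ∀ i, rank i < s → c s i ≤ u s i := by
    intro s
    induction s with
    | zero => intro _ i hi; exact absurd hi (Nat.not_lt_zero _)
    | succ s ih =>
      intro hs i hi
      refine (hc s (by omega) i).trans ((hf s (by omega) _ _ i fun j hj => ?_).trans
        (hu s (by omega) i))
      by_cases hjj : e j j
      · exact hcu s (by omega) j hjj
      · refine ih (by omega) j (lt_of_lt_of_le (Finset.card_lt_card ?_) (Nat.lt_succ_iff.1 hi))
        refine Finset.ssubset_iff_of_subset ?_ |>.2 ⟨j, by simp [hj, hjj], by simp [hjj]⟩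
        intro k hk
        simp only [Finset.mem_filter, Finset.mem_univ, true_and] at hk ⊢
        exact ⟨Dep.trans_of_isIdempotentElem he hj hk.1, hk.2⟩
  intro i
  by_cases hii : e i i
  · exact hcu n le_rfl i hii
  · refine key n le_rfl i ?_
    have : rank i < (Finset.univ : Finset (Fin n)).card :=
      Finset.card_lt_card (Finset.ssubset_univ_iff.2 fun h => by
        have := Finset.mem_univ i
        rw [← h] at this
        simp [hii] at this)
    simpa using this

/-! ## Generalization -/

theorem sum_eq_of_selfDep {p : TauAMPol n} {i : Fin n} (hi : Finsupp.single (some i) 1 ∈ p i)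
    (f : TauMon n → ℕ) : ∑ m ∈ p i, f m = f (Finsupp.single (some i) 1) +
      ∑ m ∈ p.tauPart i, f m + ∑ m ∈ p.freePart i, f m + ∑ m ∈ p.restPart i, f m := by
  classical
  have hself : p.IsSelfDepMon (Finsupp.single (some i) 1) := by
    intro j hj
    have : j = i := by
      by_contra h
      exact hj (by simp [Ne.symm h])
    subst this
    exact ⟨_, hi, by simp⟩
  have h1 : f (Finsupp.single (some i) 1) =
      ∑ m ∈ p i, if m = Finsupp.single (some i) 1 then f m else 0 := by
    rw [Finset.sum_ite_eq' (p i) _ f, if_pos hi]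
  unfold TauAMPol.tauPart TauAMPol.freePart TauAMPol.restPart
  rw [h1, Finset.sum_filter, Finset.sum_filter, Finset.sum_filter, ← Finset.sum_add_distrib,
    ← Finset.sum_add_distrib, ← Finset.sum_add_distrib]
  refine Finset.sum_congr rfl fun m _ => ?_
  by_cases hm : m = Finsupp.single (some i) 1
  · subst hm; simp [hself]
  · by_cases hs : p.IsSelfDepMon m <;> by_cases ht : m none = 0 <;> simp [hm, hs, ht]

theorem generalize_of_selfDep {p : TauAMPol n} {i : Fin n} (hi : occ p i i) : p.generalize i =
    {Finsupp.single (some i) 1} ∪ p.tauPart i ∪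
      (p.freePart i).image (fun m => m + Finsupp.single none 1) ∪ p.restPart i := by
  have : i ∈ p.selfDep := hi
  unfold TauAMPol.generalize
  rw [if_pos this]

theorem generalize_of_not_selfDep {p : TauAMPol n} {i : Fin n} (hi : ¬ occ p i i) :
    p.generalize i = p i := by
  have : i ∉ p.selfDep := hi
  unfold TauAMPol.generalize
  rw [if_neg this]

theorem sum_union_le {ι : Type*} [DecidableEq ι] (s t : Finset ι) (f : ι → ℕ) :
    ∑ i ∈ s ∪ t, f i ≤ ∑ i ∈ s, f i + ∑ i ∈ t, f i := by
  rw [← Finset.sum_union_inter]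
  exact Nat.le_add_right _ _

theorem sum_generalize_le {p : TauAMPol n} {i : Fin n} (hi : occ p i i) (f : TauMon n → ℕ) :
    ∑ m ∈ p.generalize i, f m ≤ f (Finsupp.single (some i) 1) + ∑ m ∈ p.tauPart i, f m +
      ∑ m ∈ p.freePart i, f (m + Finsupp.single none 1) + ∑ m ∈ p.restPart i, f m := by
  classical
  rw [generalize_of_selfDep hi]
  refine (sum_union_le _ _ _).trans (Nat.add_le_add_right ?_ _)
  refine (sum_union_le _ _ _).trans (Nat.add_le_add ?_ ?_)
  · refine (sum_union_le _ _ _).trans (Nat.add_le_add_right ?_ _)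
    rw [Finset.sum_singleton]
  · rw [Finset.sum_image fun a _ b _ h => add_right_cancel h]

theorem occ_generalize {p : TauAMPol n} (hp : ∀ i, occ p i i → Finsupp.single (some i) 1 ∈ p i) :
    occ p.generalize = occ p := by
  classical
  ext i j
  by_cases hi : occ p i i
  · unfold occ
    rw [generalize_of_selfDep hi]
    constructor
    · rintro ⟨m, hm, hj⟩
      simp only [Finset.mem_union, Finset.mem_singleton, Finset.mem_image] at hm
      rcases hm with ((rfl | hm) | ⟨m', hm', rfl⟩) | hm
      · exact ⟨_, hp i hi, hj⟩
      · exact ⟨m, (Finset.mem_filter.1 hm).1, hj⟩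
      · exact ⟨m', (Finset.mem_filter.1 hm').1, by simpa using hj⟩
      · exact ⟨m, (Finset.mem_filter.1 hm).1, hj⟩
    · rintro ⟨m, hm, hj⟩
      simp only [Finset.mem_union, Finset.mem_singleton, Finset.mem_image]
      by_cases h1 : m = Finsupp.single (some i) 1
      · exact ⟨m, Or.inl (Or.inl (Or.inl h1)), hj⟩
      · by_cases h2 : p.IsSelfDepMon m
        · by_cases h3 : m none = 0
          · exact ⟨_, Or.inl (Or.inr ⟨m, Finset.mem_filter.2 ⟨hm, h1, h2, h3⟩, rfl⟩),
              by simpa using hj⟩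
          · exact ⟨m, Or.inl (Or.inl (Or.inr (Finset.mem_filter.2 ⟨hm, h1, h2, h3⟩))), hj⟩
        · exact ⟨m, Or.inr (Finset.mem_filter.2 ⟨hm, h2⟩), hj⟩
  · unfold occ
    rw [generalize_of_not_selfDep hi]

theorem AGood.single_mem (hS : IsPolynomiallyBounded S) {a : TauAMPol n} (ha : AGood S a)
    {i : Fin n} (hi : occ a i i) : Finsupp.single (some i) 1 ∈ a i := by
  obtain ⟨m, hm, hmi⟩ := hi
  rwa [← ha.eq_single hS hm hmi]

theorem isIdempotentElem_occ {p : TauAMPol n} (hp : Nonconst p) (hid : p.IsIdempotent) :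
    IsIdempotentElem (occ p) := by
  have := occ_acomp p p hp
  rw [hid] at this
  exact this.symm

/-- Run `σ t` once to obtain `p` at `τ = t`, then `σ 0` for `t` times, each adding the `τ`-free
self-dependent monomials once more, then `σ t` for `n` times to restore the variables that are not
self-dependent. -/
theorem AGood.generalize (hS : IsPolynomiallyBounded S) {p : TauAMPol n} (hp : AGood S p)
    (hid : p.IsIdempotent) : AGood S p.generalize := by
  have hsingle : ∀ i, occ p i i → Finsupp.single (some i) 1 ∈ p i := fun i hi =>
    hp.single_mem hS hi
  have hocc := occ_generalize hsingle
  refine ⟨?_, by unfold Nonconst; rw [hocc]; exact hp.2⟩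
  have he := isIdempotentElem_occ hp.2 hid
  obtain ⟨C, hC⟩ := hp.1
  choose σ hσ hw hrun using hC
  -- The middle block costs only `t * C`, since `σ 0` has weight at most `C`; each run of `σ t`
  -- costs at most `C * (t + 1)`.
  refine ⟨(2 + n) * C, fun t => ⟨σ t ++ (List.replicate t (σ 0)).flatten ++
    (List.replicate n (σ t)).flatten, isTrace_append (isTrace_append (hσ t)
      (isTrace_flatten_replicate (hσ 0) t)) (isTrace_flatten_replicate (hσ t) n), ?_, ?_⟩⟩
  · rw [weight_append, weight_append, weight_flatten_replicate, weight_flatten_replicate]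
    have h1 := hw t
    have h2 := Nat.mul_le_mul_left t (hw 0)
    have h3 := Nat.mul_le_mul_left n (hw t)
    nlinarith
  intro x
  rw [run_append, run_append, run_flatten_replicate, run_flatten_replicate]
  set z : ℕ → Fin n → ℕ := fun s => (run (σ 0))^[s] (run (σ t) x) with hz
  have hzs : ∀ s, z (s + 1) = run (σ 0) (z s) := fun s => Function.iterate_succ_apply' _ _ _
  have hmid : ∀ s i, occ p i i → x i + ∑ m ∈ p.tauPart i, monVal m x t +
      (s + 1) * ∑ m ∈ p.freePart i, monVal m x t + ∑ m ∈ p.restPart i, monVal m x t ≤ z s i := by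
    intro s
    induction s with
    | zero =>
      intro i hi
      have h1 : (concretization p).val x t i ≤ z 0 i := hrun t x i
      rw [value_concretization, sum_eq_of_selfDep (hsingle i hi), monVal_single_some] at h1
      simpa using h1
    | succ s ih =>
      intro i hi
      have h1 : (concretization p).val (z s) 0 i ≤ run (σ 0) (z s) i := hrun 0 (z s) i
      rw [value_concretization, sum_eq_of_selfDep (hsingle i hi), monVal_single_some] at h1
      rw [hzs]
      have h2 : ∑ m ∈ p.freePart i, monVal m x t ≤ ∑ m ∈ p.freePart i, monVal m (z s) 0 := by
        refine Finset.sum_le_sum fun m hm => ?_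
        have hm' : p.IsSelfDepMon m ∧ m none = 0 := by
          classical
          unfold TauAMPol.freePart at hm
          exact (Finset.mem_filter.1 hm).2.2
        rw [monVal_eq_of_tau_free hm'.2 x t 0]
        refine monVal_mono (fun j hj => ?_) le_rfl
        have := ih j (hm'.1 j hj)
        omega
      have h3 := ih i hi
      rw [add_mul (s + 1), one_mul]
      omega
  have hgen : ∀ i, occ p i i → (concretization p.generalize).val x t i ≤ z t i := by
    intro i hi
    refine le_trans ?_ (hmid t i hi)
    rw [value_concretization]
    refine (sum_generalize_le hi _).trans ?_
    simp only [monVal_add, monVal_single_none, monVal_single_some]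
    rw [← Finset.sum_mul]
    have : (∑ m ∈ p.freePart i, monVal m x t) * t ≤
        (t + 1) * ∑ m ∈ p.freePart i, monVal m x t := by
      rw [mul_comm]
      exact Nat.mul_le_mul_right _ (Nat.le_succ t)
    omega
  have hstep : ∀ s, run (σ t) ((run (σ t))^[s] (z t)) = (run (σ t))^[s + 1] (z t) := fun s =>
    (Function.iterate_succ_apply' _ _ _).symm
  have hmono : ∀ s i, occ p i i → z t i ≤ (run (σ t))^[s] (z t) i := by
    intro s i hi
    induction s with
    | zero => exact le_rfl
    | succ s ih =>
      rw [← hstep]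
      refine ih.trans (le_trans ?_ (hrun t _ i))
      rw [value_concretization, sum_eq_of_selfDep (hsingle i hi), monVal_single_some]
      omega
  have hp_le : ∀ i, occ p i i → (concretization p).val x t i ≤ z t i := by
    intro i hi
    refine le_trans ?_ (hmid t i hi)
    rw [value_concretization, sum_eq_of_selfDep (hsingle i hi), monVal_single_some]
    have : ∑ m ∈ p.freePart i, monVal m x t ≤
        (t + 1) * ∑ m ∈ p.freePart i, monVal m x t := Nat.le_mul_of_pos_left _ (Nat.succ_pos t)
    omega
  -- Idempotence makes the constant sequence `p(x, t)` a lower comparison sequence, `p(x, t) ≤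
  -- p(p(x, t), t)` at `τ = t`, since abstraction only lowers coefficients.
  have hflush : (concretization p).val x t ≤ (run (σ t))^[n] (z t) := by
    refine Dep.le_of_le_selfDep he (fun _ => (concretization p).val x t)
      (fun s => (run (σ t))^[s] (z t)) (fun _ y => (concretization p).val y t) ?_ ?_ ?_ ?_
    · intro s _ a b i hab
      rw [value_concretization, value_concretization]
      exact Finset.sum_le_sum fun m hm =>
        monVal_mono (fun j hj => hab j ⟨m, hm, hj⟩) le_rfl
    · intro s _
      have h := val_concretization_abstraction_le ((concretization p).comp (concretization p)) x t
      rw [TauMPol.val_comp] at h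
      have h' : abstraction ((concretization p).comp (concretization p)) = p := hid
      rwa [h'] at h
    · intro s _
      rw [← hstep]
      exact hrun t _
    · exact fun s _ i hi => (hp_le i hi).trans (hmono s i hi)
  intro i
  by_cases hi : occ p i i
  · exact (hgen i hi).trans (hmono n i hi)
  · have := hflush i
    rw [value_concretization] at this ⊢
    rwa [generalize_of_not_selfDep hi]

/-! ## Termination -/

theorem subset_round (T : Set (TauAMPol n)) : T ⊆ round T := fun a ha =>
  Or.inl (Set.mem_iUnion.2 ⟨1, Or.inr ⟨a, ha, TauAMPol.id, rfl, (acomp_id a).symm⟩⟩)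

theorem closure_subset_aGood {T : Set (TauAMPol n)} (hT : T ⊆ {a | AGood S a}) :
    TauAMPol.closure T ⊆ {a | AGood S a} := by
  refine Set.iUnion_subset fun k => ?_
  induction k with
  | zero =>
    rintro a rfl
    exact AGood.id
  | succ k ih =>
    rintro a (ha | ⟨q, hq, p, hp, rfl⟩)
    · exact ih ha
    · exact (hT hq).acomp (ih hp)

theorem round_subset_aGood (hS : IsPolynomiallyBounded S) {T : Set (TauAMPol n)}
    (hT : T ⊆ {a | AGood S a}) : round T ⊆ {a | AGood S a} := by
  rintro a (ha | ⟨p, hp, hid, rfl⟩)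
  · exact closure_subset_aGood hT ha
  · exact AGood.generalize hS (closure_subset_aGood hT hp) hid

/-- The rounds form an increasing chain inside the finite set of good tuples, so two consecutive
ones coincide. -/
theorem exists_returns (hS : IsPolynomiallyBounded S)
    (hvars : ∀ p ∈ S, ∀ i : Fin n, (p i).vars.Nonempty) :
    ∃ A : Finset (TauAMPol n), Returns S A ∧ (∀ a ∈ A, AGood S a) := by
  have hfin := finite_setOf_aGood hS
  have hgood : ∀ k, round^[k] (start S) ⊆ {a | AGood S a} := by
    intro k
    induction k with
    | zero =>
      rintro a ⟨p, hp, rfl⟩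
      exact AGood.toTau hp (hvars p hp)
    | succ k ih =>
      rw [Function.iterate_succ_apply']
      exact round_subset_aGood hS ih
  have hstab : ∃ k, round (round^[k] (start S)) = round^[k] (start S) := by
    by_contra! h
    have hcard : ∀ k, k ≤ (round^[k] (start S)).ncard := by
      intro k
      induction k with
      | zero => exact Nat.zero_le _
      | succ k ih =>
        rw [Function.iterate_succ_apply']
        refine Nat.succ_le_of_lt (lt_of_le_of_lt ih (Set.ncard_lt_ncard
          ((subset_round _).ssubset_of_ne (h k).symm) (hfin.subset ?_)))
        have := hgood (k + 1)
        rwa [Function.iterate_succ_apply'] at this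
    have h1 := hcard ({a | AGood S a}.ncard + 1)
    have h2 := Set.ncard_le_ncard (hgood ({a | AGood S a}.ncard + 1)) hfin
    omega
  obtain ⟨k, hk⟩ := hstab
  have hkf : (round^[k] (start S)).Finite := hfin.subset (hgood k)
  refine ⟨hkf.toFinset, ⟨⟨k, by simp⟩, by simpa using hk⟩, fun a ha => hgood k ?_⟩
  simpa using ha

/-! ### Closure properties of the returned set -/

theorem Returns.closure_subset {A : Finset (TauAMPol n)} (hA : Returns S A) {a : TauAMPol n}
    (ha : a ∈ TauAMPol.closure (A : Set (TauAMPol n))) : a ∈ A := by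
  have : a ∈ round (A : Set (TauAMPol n)) := Or.inl ha
  rw [hA.2] at this
  exact this

theorem Returns.id_mem {A : Finset (TauAMPol n)} (hA : Returns S A) : TauAMPol.id ∈ A :=
  hA.closure_subset (Set.mem_iUnion.2 ⟨0, rfl⟩)

theorem Returns.acomp_mem {A : Finset (TauAMPol n)} (hA : Returns S A) {q p : TauAMPol n}
    (hq : q ∈ A) (hp : p ∈ A) : q.acomp p ∈ A :=
  hA.closure_subset (Set.mem_iUnion.2
    ⟨2, Or.inr ⟨q, hq, p, Or.inr ⟨p, hp, TauAMPol.id, rfl, (acomp_id p).symm⟩, rfl⟩⟩)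

theorem Returns.generalize_mem {A : Finset (TauAMPol n)} (hA : Returns S A) {p : TauAMPol n}
    (hp : p ∈ A) (hid : p.IsIdempotent) : p.generalize ∈ A := by
  have : p.generalize ∈ round (A : Set (TauAMPol n)) :=
    Or.inr ⟨p, Set.mem_iUnion.2 ⟨1, Or.inr ⟨p, hp, TauAMPol.id, rfl, (acomp_id p).symm⟩⟩, hid, rfl⟩
  rw [hA.2] at this
  exact this

theorem Returns.toTau_mem {A : Finset (TauAMPol n)} (hA : Returns S A) {p : MPol n}
    (hp : p ∈ S) : abstraction p.toTau ∈ A := by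
  obtain ⟨⟨k, hk⟩, -⟩ := hA
  have : ∀ k, start S ⊆ round^[k] (start S) := by
    intro k
    induction k with
    | zero => exact subset_rfl
    | succ k ih =>
      rw [Function.iterate_succ_apply']
      exact ih.trans (subset_round _)
  have h := this k ⟨p, hp, rfl⟩
  rw [hk] at h
  exact h


variable {n : ℕ}

/-! ## Coefficients of compositions -/

section GenericCoefficients

open MvPolynomial

/-- If the value at the all-one point is at most `1`, a nonzero `f` is a single monomial with
coefficient `1`. Then one variable alone is responsible for the value `2`. Applied to coefficients
of compositions, this traces a coefficient `≥ 2` back to at most one source. -/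
theorem two_le_eval {V : Type*} [DecidableEq V] (f : MvPolynomial V ℕ) (c : V → ℕ)
    (h : 2 ≤ eval c f) :
    2 ≤ eval (fun _ => 1) f ∨ ∃ v, 2 ≤ c v ∧ 2 ≤ eval (Function.update (fun _ => 1) v 2) f := by
  by_cases h1 : 2 ≤ eval (fun _ => 1) f
  · exact Or.inl h1
  refine Or.inr ?_
  have hsum : ∑ d ∈ f.support, coeff d f ≤ 1 := by
    rw [eval_eq] at h1
    simp only [one_pow, Finset.prod_const_one, mul_one] at h1
    omega
  have hne : f.support.Nonempty := by
    rw [Finset.nonempty_iff_ne_empty, ne_eq, support_eq_empty]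
    rintro rfl
    simp at h
  obtain ⟨d, hd⟩ := hne
  have hd1 : 1 ≤ coeff d f := Nat.one_le_iff_ne_zero.2 (mem_support_iff.1 hd)
  have hf : f = monomial d 1 := by
    ext d'
    rw [coeff_monomial]
    rw [← Finset.add_sum_erase _ _ hd] at hsum
    by_cases hdd : d = d'
    · subst hdd
      rw [if_pos rfl]
      omega
    · rw [if_neg hdd]
      by_contra hne
      have h2 := Finset.single_le_sum (f := fun d => coeff d f) (fun _ _ => Nat.zero_le _)
        (Finset.mem_erase.2 ⟨Ne.symm hdd, mem_support_iff.2 hne⟩)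
      have h3 : MvPolynomial.coeff d' f ≤ _ := h2
      omega
  subst hf
  rw [eval_monomial, one_mul] at h
  have hv : ∃ v ∈ d.support, 2 ≤ c v := by
    by_contra! hlt
    have : d.prod (fun v k => c v ^ k) ≤ 1 := Finset.prod_le_one' fun v hv =>
      pow_le_one' (Nat.lt_succ_iff.1 (hlt v hv)) _
    omega
  obtain ⟨v, hv, hcv⟩ := hv
  refine ⟨v, hcv, ?_⟩
  rw [eval_monomial, one_mul]
  have h3 : (Function.update (fun _ => 1) v 2 v : ℕ) ^ d v ≤
      d.prod fun w k => (Function.update (fun _ => 1) v 2 w : ℕ) ^ k := by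
    refine Finset.single_le_prod' (f := fun w => (Function.update (fun _ => 1) v 2 w : ℕ) ^ d w)
      (fun w _ => Nat.one_le_pow _ _ ?_) hv
    by_cases hw : w = v
    · subst hw; simp
    · simp [hw]
  refine le_trans ?_ h3
  rw [Function.update_self]
  calc 2 = 2 ^ 1 := rfl
    _ ≤ _ := Nat.pow_le_pow_right (by norm_num)
      (Nat.one_le_iff_ne_zero.2 (Finsupp.mem_support_iff.1 hv))

/-- The polynomial with the same monomials as `q` and with the coefficients `c`. -/
def withCoeffs (q : TauMPol n) (c : Fin n × TauMon n → ℕ) : TauMPol n :=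
  fun i => ∑ d ∈ (q i).support, monomial d (c (i, d))

theorem coeff_withCoeffs (q : TauMPol n) (c : Fin n × TauMon n → ℕ) (i : Fin n) (m : TauMon n)
    [Decidable (m ∈ (q i).support)] :
    (withCoeffs q c i).coeff m = if m ∈ (q i).support then c (i, m) else 0 := by
  classical
  simp only [withCoeffs, coeff_sum, coeff_monomial]
  rw [Finset.sum_ite_eq' (q i).support m]
  split_ifs <;> rfl

theorem withCoeffs_self (q : TauMPol n) : withCoeffs q (fun v => (q v.1).coeff v.2) = q :=
  funext fun i => (as_sum (q i)).symm

theorem withCoeffs_one (q : TauMPol n) :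
    withCoeffs q (fun _ => 1) = concretization (abstraction q) := rfl

/-- Compose with indeterminate coefficients, one for each monomial of `q` and `p`; the coefficient
of `m` is the required polynomial, as specialization commutes with substitution. -/
theorem exists_coeff_comp_eq_eval (q p : TauMPol n) (i : Fin n) (m : TauMon n) :
    ∃ f : MvPolynomial ((Fin n × TauMon n) ⊕ (Fin n × TauMon n)) ℕ, ∀ c,
      eval c f = (((withCoeffs q (c ∘ Sum.inl)).comp (withCoeffs p (c ∘ Sum.inr))) i).coeff m := by
  let V := (Fin n × TauMon n) ⊕ (Fin n × TauMon n)
  let P : Option (Fin n) → MvPolynomial (Option (Fin n)) (MvPolynomial V ℕ) := fun o =>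
    o.elim (X none) fun j => ∑ r ∈ (p j).support, monomial r (X (Sum.inr (j, r)))
  let Q : MvPolynomial (Option (Fin n)) (MvPolynomial V ℕ) :=
    ∑ d ∈ (q i).support, monomial d (X (Sum.inl (i, d)))
  refine ⟨coeff m (bind₁ P Q), fun c => ?_⟩
  rw [← coeff_map, map_bind₁]
  unfold TauMPol.comp
  congr 2
  · congr 1
    funext o
    cases o with
    | none => simp [P]
    | some j => simp [P, withCoeffs, map_monomial]
  · simp [Q, withCoeffs, map_monomial]

end GenericCoefficients

/-! ## Multi-polynomials with tight coefficients -/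

open Classical in
/-- The abstract multi-polynomial `a`, with a second copy of the monomial `m` in component `i`. -/
def mark (a : TauAMPol n) (i : Fin n) (m : TauMon n) : TauMPol n :=
  fun k => concretization a k + if k = i then MvPolynomial.monomial m 1 else 0

/-- The abstraction of `b` is realized by traces, and this remains true if one of the coefficients
that are at least `2` in `b` is raised to `2`. -/
structure Good (S : Finset (MPol n)) (b : TauMPol n) : Prop where
  aGood : AGood S (abstraction b)
  mark : ∀ i m, 2 ≤ (b i).coeff m → Realizable S (mark (abstraction b) i m)

variable {S : Finset (MPol n)}

theorem withCoeffs_update (q : TauMPol n) (i : Fin n) (m : TauMon n) (hm : m ∈ (q i).support)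
    [DecidableEq (Fin n × TauMon n)] :
    withCoeffs q (Function.update (fun _ => 1) (i, m) 2) = mark (abstraction q) i m := by
  classical
  funext k
  ext m'
  rw [coeff_withCoeffs]
  unfold mark
  rw [MvPolynomial.coeff_add, coeff_concretization]
  by_cases hk : k = i
  · subst hk
    rw [if_pos rfl, MvPolynomial.coeff_monomial]
    by_cases hmm : m = m'
    · subst hmm
      simp [hm, abstraction]
    · have h1 : (k, m') ≠ (k, m) := fun h => hmm (congrArg Prod.snd h).symm
      simp [Function.update_of_ne h1, hmm, abstraction]
  · have h1 : (k, m') ≠ (i, m) := fun h => hk (congrArg Prod.fst h)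
    simp [hk, abstraction]

theorem abstraction_mark {a : TauAMPol n} {i : Fin n} {m : TauMon n} (hm : m ∈ a i) :
    abstraction (mark a i m) = a := by
  classical
  funext k
  conv_rhs => rw [← abstraction_concretization a]
  ext m'
  unfold abstraction mark
  rw [mem_support_add_iff]
  refine or_iff_left_of_imp fun h => ?_
  split_ifs at h with hk
  · subst hk
    rw [MvPolynomial.mem_support_iff, MvPolynomial.coeff_monomial] at h
    have : m = m' := by
      by_contra hne
      exact h (if_neg hne)
    subst this
    rw [MvPolynomial.mem_support_iff, coeff_concretization, if_pos hm]
    exact one_ne_zero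
  · simp at h

theorem Realizable.mark_of_two_le {F : TauMPol n} (hF : Realizable S F) {i : Fin n} {m : TauMon n}
    (hm : 2 ≤ (F i).coeff m) : Realizable S (SDL.mark (abstraction F) i m) := by
  classical
  refine hF.of_coeff_le fun k m' => ?_
  unfold SDL.mark
  rw [MvPolynomial.coeff_add]
  have h1 := coeff_concretization_abstraction_le F k m'
  split_ifs with hk
  · subst hk
    rw [MvPolynomial.coeff_monomial]
    split_ifs with hmm
    · subst hmm
      rw [coeff_concretization]
      split_ifs <;> omega
    · exact h1
  · simpa using h1

/-- By `two_le_eval`, a coefficient `≥ 2` of the composition is already `≥ 2` when all coefficients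
of `q` and `p` are replaced by `1`, except possibly one that is replaced by `2`. Such modified
factors are realizable by hypothesis. -/
theorem Good.comp {q p : TauMPol n} (hq : Good S q) (hp : Good S p) : Good S (q.comp p) := by
  classical
  refine ⟨by rw [abstraction_comp]; exact hq.aGood.acomp hp.aGood, fun i m hm => ?_⟩
  obtain ⟨f, hf⟩ := exists_coeff_comp_eq_eval q p i m
  have hc := hf (Sum.elim (fun v => (q v.1).coeff v.2) fun v => (p v.1).coeff v.2)
  rw [Sum.elim_comp_inl, Sum.elim_comp_inr, withCoeffs_self, withCoeffs_self] at hc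
  rw [← hc] at hm
  have hq1 : abstraction (concretization (abstraction q)) = abstraction q :=
    abstraction_concretization _
  have hp1 : abstraction (concretization (abstraction p)) = abstraction p :=
    abstraction_concretization _
  rcases two_le_eval f _ hm with h | ⟨v | v, hv, h⟩
  · rw [hf] at h
    rw [← abstraction_comp_congr hq1 hp1]
    exact (hq.aGood.1.comp hp.aGood.1).mark_of_two_le h
  · rw [hf, Sum.update_inl_comp_inl, Sum.update_inl_comp_inr] at h
    have hv' : v.2 ∈ (q v.1).support := by
      rw [MvPolynomial.mem_support_iff]
      simp only [Sum.elim_inl] at hv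
      omega
    have h1 := withCoeffs_update q v.1 v.2 hv'
    change 2 ≤ (((withCoeffs q (Function.update (fun _ => 1) v 2)).comp
      (withCoeffs p fun _ => 1)) i).coeff m at h
    rw [h1, withCoeffs_one] at h
    rw [← abstraction_comp_congr (abstraction_mark hv') hp1]
    exact ((hq.mark _ _ hv).comp hp.aGood.1).mark_of_two_le h
  · rw [hf, Sum.update_inr_comp_inl, Sum.update_inr_comp_inr] at h
    have hv' : v.2 ∈ (p v.1).support := by
      rw [MvPolynomial.mem_support_iff]
      simp only [Sum.elim_inr] at hv
      omega
    have h1 := withCoeffs_update p v.1 v.2 hv'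
    change 2 ≤ (((withCoeffs q fun _ => 1).comp
      (withCoeffs p (Function.update (fun _ => 1) v 2))) i).coeff m at h
    rw [h1, withCoeffs_one] at h
    rw [← abstraction_comp_congr hq1 (abstraction_mark hv')]
    exact (hq.aGood.1.comp (hp.mark _ _ hv)).mark_of_two_le h

theorem Good.toTau {p : MPol n} (hp : p ∈ S) (hv : ∀ i, (p i).vars.Nonempty) :
    Good S p.toTau :=
  ⟨AGood.toTau hp hv, fun _ _ hm => (realizable_toTau hp).mark_of_two_le hm⟩

theorem Good.one : Good S TauMPol.one :=
  ⟨by rw [abstraction_one]; exact AGood.id, fun _ _ hm => realizable_one.mark_of_two_le hm⟩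

theorem val_mark (a : TauAMPol n) (i : Fin n) (m : TauMon n) (x : Fin n → ℕ) (t : ℕ) :
    (mark a i m).val x t i = ∑ m' ∈ a i, monVal m' x t + monVal m x t := by
  rw [← value_concretization]
  unfold TauMPol.val mark
  rw [if_pos rfl, TauPol.value_add, TauPol.value_monomial, one_mul]

theorem val_mark_of_ne (a : TauAMPol n) {i k : Fin n} (hk : k ≠ i) (m : TauMon n)
    (x : Fin n → ℕ) (t : ℕ) : (mark a i m).val x t k = (concretization a).val x t k := by
  unfold TauMPol.val mark
  rw [if_neg hk, add_zero]

/-- With coefficient at least `2`, the marked tuple would be realizable and would double `x_i`. This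
keeps the iterated upper bounds from growing exponentially. -/
theorem Good.coeff_single_le_one (hS : IsPolynomiallyBounded S) {b : TauMPol n} (hb : Good S b)
    (i : Fin n) : (b i).coeff (Finsupp.single (some i) 1) ≤ 1 := by
  by_contra! h
  have hm : Finsupp.single (some i) 1 ∈ abstraction b i := by
    unfold abstraction
    rw [MvPolynomial.mem_support_iff]
    omega
  refine (hb.mark i _ h).not_doubling hS (fun y hy j => ?_) i fun y hy => ?_
  · refine (two_le_val_concretization hb.aGood.2 hy one_le_two j).trans ?_
    by_cases hj : j = i
    · subst hj
      rw [val_mark, value_concretization]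
      exact Nat.le_add_right _ _
    · rw [val_mark_of_ne _ hj]
  · rw [val_mark, monVal_single_some]
    have := Finset.single_le_sum (f := fun m => monVal m y 2) (fun _ _ => Nat.zero_le _) hm
    simp only [monVal_single_some] at this
    omega

/-! ## Rescaling of `τ` -/

theorem pow_mul_monVal (m : TauMon n) (D : ℕ) (x : Fin n → ℕ) (t : ℕ) :
    D ^ m none * monVal m x t = monVal m x (D * t) := by
  classical
  have h : D ^ m none = m.prod fun o k => (o.elim D fun _ => 1 : ℕ) ^ k := by
    unfold Finsupp.prod
    by_cases hm : m none = 0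
    · rw [hm, pow_zero, eq_comm]
      refine Finset.prod_eq_one fun o ho => ?_
      cases o with
      | none => simp [hm]
      | some j => simp
    · rw [Finset.prod_eq_single none]
      · rfl
      · intro o _ ho
        cases o with
        | none => exact absurd rfl ho
        | some j => simp
      · intro h
        exact absurd (Finsupp.mem_support_iff.2 hm) h
  rw [h]
  unfold monVal Finsupp.prod
  rw [← Finset.prod_mul_distrib]
  refine Finset.prod_congr rfl fun o _ => ?_
  rw [← mul_pow]
  cases o with
  | none => rfl
  | some j => simp

/-- The abstract multi-polynomial `a`, with `D τ` in place of `τ`. -/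
def rescale (D : ℕ) (a : TauAMPol n) : TauMPol n :=
  fun i => ∑ m ∈ a i, MvPolynomial.monomial m (D ^ m none)

theorem coeff_rescale (D : ℕ) (a : TauAMPol n) (i : Fin n) (m : TauMon n) [Decidable (m ∈ a i)] :
    (rescale D a i).coeff m = if m ∈ a i then D ^ m none else 0 := by
  classical
  simp only [rescale, MvPolynomial.coeff_sum, MvPolynomial.coeff_monomial]
  rw [Finset.sum_ite_eq' (a i) m]
  split_ifs <;> rfl

theorem val_rescale (D : ℕ) (a : TauAMPol n) (x : Fin n → ℕ) (t : ℕ) (i : Fin n) :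
    (rescale D a).val x t i = ∑ m ∈ a i, monVal m x (D * t) := by
  unfold TauMPol.val rescale
  rw [TauPol.value_sum]
  exact Finset.sum_congr rfl fun m _ => by rw [TauPol.value_monomial, pow_mul_monVal]

theorem abstraction_rescale {D : ℕ} (hD : 1 ≤ D) (a : TauAMPol n) :
    abstraction (rescale D a) = a := by
  classical
  funext i
  ext m
  unfold abstraction
  rw [MvPolynomial.mem_support_iff, coeff_rescale]
  have : D ≠ 0 := by omega
  simp [this]

/-- Only monomials containing `τ` receive a coefficient above `1`, and a second copy of such a
monomial is paid for by doubling `τ`. -/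
theorem Good.rescale {D : ℕ} (hD : 1 ≤ D) {a : TauAMPol n} (ha : AGood S a) :
    Good S (rescale D a) := by
  classical
  rw [← abstraction_rescale hD a] at ha
  refine ⟨ha, fun i m hm => ?_⟩
  rw [abstraction_rescale hD a] at ha ⊢
  rw [coeff_rescale] at hm
  have hma : m ∈ a i := by
    by_contra h
    rw [if_neg h] at hm
    omega
  rw [if_pos hma] at hm
  have hm0 : m none ≠ 0 := by
    intro h
    rw [h, pow_zero] at hm
    omega
  refine ha.1.of_le_rescale 2 fun x t k => ?_
  by_cases hk : k = i
  · subst hk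
    rw [val_mark, value_concretization]
    have h1 : monVal m x t = ∑ m' ∈ a k, if m' = m then monVal m' x t else 0 := by
      rw [Finset.sum_ite_eq' (a k) m, if_pos hma]
    rw [h1, ← Finset.sum_add_distrib]
    refine Finset.sum_le_sum fun m' _ => ?_
    split_ifs with h
    · subst h
      rw [← two_mul]
      exact mul_monVal_le hm0 2 x t
    · exact monVal_mono (fun _ _ => le_rfl) (by omega)
  · rw [val_mark_of_ne _ hk]
    exact (concretization a).val_mono le_rfl (by omega) k

/-! ## Bounds -/

theorem bounds_iff {b : TauMPol n} {σ : List (MPol n)} :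
    Bounds b σ ↔ ∀ x t, weight σ ≤ t → run σ x ≤ b.val x t :=
  ⟨fun h x t ht j => h j x t ht, fun h j x t ht => h x t ht j⟩

theorem Bounds.append {b c : TauMPol n} {σ ρ : List (MPol n)} (hb : Bounds b σ)
    (hc : Bounds c ρ) : Bounds (c.comp b) (σ ++ ρ) := by
  rw [bounds_iff] at hb hc ⊢
  intro x t ht
  rw [weight_append] at ht
  rw [run_append, TauMPol.val_comp]
  exact (run_mono ρ (hb x t (by omega))).trans (hc _ t (by omega))

theorem bounds_one_nil : Bounds (TauMPol.one (n := n)) [] := by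
  rw [bounds_iff]
  intro x t _ i
  simp [TauMPol.val, TauMPol.one, TauPol.value, run]

theorem bounds_toTau (p : MPol n) : Bounds p.toTau [p] := by
  rw [bounds_iff]
  intro x t _
  rw [val_toTau]


variable {n : ℕ} {S : Finset (MPol n)} {A : Finset (TauAMPol n)}

/-! ## Bounds for sequences of transitions with the same idempotent dependence relation -/

/-- The multi-polynomial `b` may be used as a bound for traces with dependence relation `e`. -/
structure Adm (S : Finset (MPol n)) (A : Finset (TauAMPol n)) (e : Dep n) (b : TauMPol n) :
    Prop where
  good : Good S b
  mem : abstraction b ∈ A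
  occ_eq : occ (abstraction b) = e

theorem Adm.comp (hA : Returns S A) {d e : Dep n} {q p : TauMPol n} (hq : Adm S A e q)
    (hp : Adm S A d p) : Adm S A (d * e) (q.comp p) := by
  refine ⟨hq.good.comp hp.good, ?_, ?_⟩
  · rw [abstraction_comp]
    exact hA.acomp_mem hq.mem hp.mem
  · rw [abstraction_comp, occ_acomp _ _ hp.good.aGood.2, hp.occ_eq, hq.occ_eq]

theorem Adm.one (hA : Returns S A) : Adm S A 1 TauMPol.one :=
  ⟨Good.one, by rw [abstraction_one]; exact hA.id_mem, by rw [abstraction_one, occ_id]⟩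

theorem Adm.toTau (hA : Returns S A) {p : MPol n} (hp : p ∈ S)
    (hv : ∀ i, (p i).vars.Nonempty) : Adm S A (occ (abstraction p.toTau)) p.toTau :=
  ⟨Good.toTau hp hv, hA.toTau_mem hp, rfl⟩

theorem Adm.comp_self (hA : Returns S A) {e : Dep n} (he : IsIdempotentElem e) {q p : TauMPol n}
    (hq : Adm S A e q) (hp : Adm S A e p) : Adm S A e (q.comp p) := by
  have := hq.comp hA hp
  rwa [he.eq] at this

theorem Adm.single_mem (hS : IsPolynomiallyBounded S) {e : Dep n} {b : TauMPol n}
    (hb : Adm S A e b) {i : Fin n} (hi : e i i) :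
    Finsupp.single (some i) 1 ∈ abstraction b i :=
  hb.good.aGood.single_mem hS (by rwa [hb.occ_eq])

theorem le_val_of_single_mem {b : TauMPol n} {i : Fin n}
    (h : Finsupp.single (some i) 1 ∈ abstraction b i) (x : Fin n → ℕ) (t : ℕ) :
    x i ≤ b.val x t i := by
  refine le_trans ?_ (val_concretization_abstraction_le b x t i)
  rw [value_concretization]
  have := Finset.single_le_sum (f := fun m => monVal m x t) (fun _ _ => Nat.zero_le _) h
  simpa only [monVal_single_some] using this

theorem Adm.val_le {e : Dep n} {b : TauMPol n} (hb : Adm S A e b) {x y : Fin n → ℕ} {s t : ℕ}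
    (ht : s ≤ t) (i : Fin n) (h : ∀ j, e i j → x j ≤ y j) : b.val x s i ≤ b.val y t i := by
  refine TauPol.value_mono (fun j hj => h j ?_) ht
  rw [← hb.occ_eq]
  exact hj

/-- Distinct self-dependent variables do not depend on each other. -/
theorem Adm.antisymm (hS : IsPolynomiallyBounded S) {e : Dep n} (he : IsIdempotentElem e)
    {b : TauMPol n} (hb : Adm S A e b) {i j : Fin n} (hij : e i j) (hji : e j i) : i = j := by
  by_contra hne
  set F := concretization (abstraction b) with hF
  have hg := hb.good.aGood
  have h2 : ∀ y : Fin n → ℕ, (∀ k, 2 ≤ y k) → ∀ k, 2 ≤ F.val y 2 k := fun y hy k =>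
    two_le_val_concretization hg.2 hy one_le_two k
  -- Two steps double `x_i`: after the first, both `x_i` and `x_j` are at least the old `x_i`, and
  -- the second adds them.
  refine (hg.1.comp hg.1).not_doubling hS (fun y hy k => ?_) i fun y hy => ?_
  · rw [TauMPol.val_comp]
    exact h2 _ (h2 y hy) k
  · rw [TauMPol.val_comp, ← hF]
    have hi := hb.single_mem hS (Dep.trans_of_isIdempotentElem he hij hji)
    set u := F.val y 2 with hu
    rw [← hb.occ_eq] at hij hji
    obtain ⟨m, hm, hmj⟩ := hij
    obtain ⟨m', hm', hmi'⟩ := hji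
    have hmne : Finsupp.single (some i) 1 ≠ m := by
      rintro rfl
      exact hmj (by simp [hne])
    have h1 : u i + monVal m u 2 ≤ F.val u 2 i := by
      classical
      rw [hF, value_concretization, ← monVal_single_some i u 2,
        ← Finset.sum_pair (f := fun m => monVal m u 2) hmne]
      refine Finset.sum_le_sum_of_subset ?_
      intro a ha
      rcases Finset.mem_insert.1 ha with rfl | ha
      · exact hi
      · rwa [Finset.mem_singleton.1 ha]
    have h3 : u j ≤ monVal m u 2 :=
      le_monVal hmj (fun k => one_le_two.trans (h2 y hy k)) one_le_two
    have h4 : y i ≤ u i := (le_val_of_single_mem (b := F)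
      (by rw [hF, abstraction_concretization]; exact hi) y 2)
    have h5 : y i ≤ u j := by
      rw [hu, hF, value_concretization]
      exact (le_monVal hmi' (fun k => by have := hy k; omega) one_le_two).trans
        (Finset.single_le_sum (f := fun m => monVal m y 2) (fun _ _ => Nat.zero_le _) hm')
    omega

/-! ### Compositions of sequences of transitions -/

/-- The composition of the first `m` members of a sequence of multi-polynomials. -/
def prodSeq (b : ℕ → TauMPol n) : ℕ → TauMPol n
  | 0 => TauMPol.one
  | m + 1 => (b m).comp (prodSeq b m)

/-- The compositions of `m` members of `B`. -/
def prods (B : Set (TauMPol n)) : ℕ → Set (TauMPol n)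
  | 0 => {TauMPol.one}
  | m + 1 => Set.image2 TauMPol.comp B (prods B m)

theorem finite_prods {B : Set (TauMPol n)} (hB : B.Finite) (m : ℕ) : (prods B m).Finite := by
  induction m with
  | zero => exact Set.finite_singleton _
  | succ m ih => exact hB.image2 _ ih

theorem prodSeq_mem {B : Set (TauMPol n)} {b : ℕ → TauMPol n} (hb : ∀ l, b l ∈ B) (m : ℕ) :
    prodSeq b m ∈ prods B m := by
  induction m with
  | zero => rfl
  | succ m ih => exact ⟨_, hb m, _, ih, rfl⟩

theorem val_prodSeq_zero (b : ℕ → TauMPol n) (x : Fin n → ℕ) (t : ℕ) :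
    (prodSeq b 0).val x t = x := by
  funext i
  simp [prodSeq, TauMPol.val, TauMPol.one, TauPol.value]

theorem val_prodSeq_succ (b : ℕ → TauMPol n) (m : ℕ) (x : Fin n → ℕ) (t : ℕ) :
    (prodSeq b (m + 1)).val x t = (b m).val ((prodSeq b m).val x t) t :=
  TauMPol.val_comp _ _ _ _

section Prods

variable {e : Dep n} {B : Set (TauMPol n)}

theorem Adm.comp_prods (hA : Returns S A) (he : IsIdempotentElem e)
    (hB : ∀ b ∈ B, Adm S A e b) {m : ℕ} {c s : TauMPol n} (hc : c ∈ prods B m)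
    (hs : Adm S A e s) : Adm S A e (s.comp c) := by
  induction m generalizing c s with
  | zero =>
    rw [show c = TauMPol.one from hc, TauMPol.comp_one]
    exact hs
  | succ m ih =>
    obtain ⟨b, hb, c, hc, rfl⟩ := hc
    rw [← TauMPol.comp_assoc]
    exact ih hc (hs.comp_self hA he (hB b hb))

theorem Adm.prods_comp (hA : Returns S A) (he : IsIdempotentElem e)
    (hB : ∀ b ∈ B, Adm S A e b) {m : ℕ} {c s : TauMPol n} (hc : c ∈ prods B m)
    (hs : Adm S A e s) : Adm S A e (c.comp s) := by
  induction m generalizing c s with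
  | zero =>
    rw [show c = TauMPol.one from hc, TauMPol.one_comp]
    exact hs
  | succ m ih =>
    obtain ⟨b, hb, c, hc, rfl⟩ := hc
    rw [TauMPol.comp_assoc]
    exact (hB b hb).comp_self hA he (ih hc hs)

theorem Adm.of_mem_prods (hA : Returns S A) (he : IsIdempotentElem e)
    (hB : ∀ b ∈ B, Adm S A e b) {m : ℕ} {c : TauMPol n} (hc : c ∈ prods B (m + 1)) :
    Adm S A e c := by
  obtain ⟨b, hb, c, hc, rfl⟩ := hc
  exact Adm.comp_prods hA he hB hc (hB b hb)

theorem single_mem_of_mem_prods (hS : IsPolynomiallyBounded S)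
    (hB : ∀ b ∈ B, Adm S A e b) {m : ℕ} {c : TauMPol n} (hc : c ∈ prods B m) {i : Fin n}
    (hi : e i i) : Finsupp.single (some i) 1 ∈ abstraction c i := by
  induction m generalizing c with
  | zero =>
    rw [show c = TauMPol.one from hc, abstraction_one]
    simp [TauAMPol.id]
  | succ m ih =>
    obtain ⟨b, hb, c, hc, rfl⟩ := hc
    rw [abstraction_comp]
    exact mem_acomp_of_single_left ((hB b hb).single_mem hS hi) (ih hc)

theorem le_val_prodSeq (hS : IsPolynomiallyBounded S)
    (hB : ∀ b ∈ B, Adm S A e b) {b : ℕ → TauMPol n} (hb : ∀ l, b l ∈ B) (m : ℕ) {i : Fin n}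
    (hi : e i i) (x : Fin n → ℕ) (t : ℕ) : x i ≤ (prodSeq b m).val x t i :=
  le_val_of_single_mem (single_mem_of_mem_prods hS hB (prodSeq_mem hb m) hi) x t

/-- A sequence of states is bounded by the last `n` of the transitions, applied to any state that
dominates the self-dependent variables. -/
theorem le_val_prodSeq_of_selfDep (hS : IsPolynomiallyBounded S) (he : IsIdempotentElem e)
    (hB : ∀ b ∈ B, Adm S A e b) {b : ℕ → TauMPol n} (hb : ∀ l, b l ∈ B) (y : ℕ → Fin n → ℕ)
    (v : Fin n → ℕ) (T : ℕ) (hy : ∀ s < n, y (s + 1) ≤ (b s).val (y s) T)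
    (hv : ∀ s ≤ n, ∀ i, e i i → y s i ≤ v i) : y n ≤ (prodSeq b n).val v T := by
  refine Dep.le_of_le_selfDep he y (fun s => (prodSeq b s).val v T) (fun s z => (b s).val z T)
    (fun s _ x z i h => (hB _ (hb s)).val_le le_rfl i h) hy (fun s _ => ?_)
    (fun s hs i hi => (hv s hs i hi).trans (le_val_prodSeq hS hB hb s hi v T))
  rw [val_prodSeq_succ]

/-- The monomials of `a i` other than `x_i` in which all variables are self-dependent. -/
def selfDepPart (e : Dep n) (a : TauAMPol n) (i : Fin n) : Set (TauMon n) :=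
  {m | m ∈ a i ∧ m ≠ Finsupp.single (some i) 1 ∧ ∀ j, m (some j) ≠ 0 → e j j}

/-- As `x_i` occurs in component `i` for self-dependent `i`, composition on either side keeps the
self-dependent monomials of both factors. The tuples of `A` containing all of them thus form a
finite nonempty semigroup, and this has an idempotent. -/
theorem exists_idempotent (hA : Returns S A) (he : IsIdempotentElem e)
    (hS : IsPolynomiallyBounded S) (hAg : ∀ a ∈ A, AGood S a) {Q : Set (TauMPol n)}
    (hQ : Q.Finite) (hQA : ∀ s ∈ Q, Adm S A e s) {b₀ : TauMPol n} (hb₀ : Adm S A e b₀) :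
    ∃ g ∈ A, g.IsIdempotent ∧ occ g = e ∧
      ∀ s ∈ Q, ∀ i, e i i → selfDepPart e (abstraction s) i ⊆ selfDepPart e g i := by
  let I : Set (TauMPol n) → Set (TauAMPol n) := fun Q => {a | a ∈ A ∧ occ a = e ∧
    ∀ s ∈ Q, ∀ i, e i i → selfDepPart e (abstraction s) i ⊆ selfDepPart e a i}
  have hsingle : ∀ a ∈ A, occ a = e → ∀ i, e i i → Finsupp.single (some i) 1 ∈ a i :=
    fun a ha hae i hi => (hAg a ha).single_mem hS (by rwa [hae])
  have hmul : ∀ a ∈ A, ∀ b ∈ A, occ a = e → occ b = e → a.acomp b ∈ A ∧ occ (a.acomp b) = e ∧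
      ∀ i, e i i → selfDepPart e a i ⊆ selfDepPart e (a.acomp b) i ∧
        selfDepPart e b i ⊆ selfDepPart e (a.acomp b) i := by
    intro a ha b hb hae hbe
    refine ⟨hA.acomp_mem ha hb, ?_, fun i hi => ⟨?_, ?_⟩⟩
    · rw [occ_acomp _ _ (hAg b hb).2, hae, hbe, he.eq]
    · exact fun m hm => ⟨mem_acomp_of_single_right hm.1 fun j hj =>
        hsingle b hb hbe j (hm.2.2 j hj), hm.2⟩
    · exact fun m hm => ⟨mem_acomp_of_single_left (hsingle a ha hae i hi) hm.1, hm.2⟩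
  have hne : (I Q).Nonempty := by
    induction Q, hQ using Set.Finite.induction_on with
    | empty => exact ⟨_, hb₀.mem, hb₀.occ_eq, fun s hs => hs.elim⟩
    | @insert s Q _ _ ih =>
      obtain ⟨a, haA, hae, ha⟩ := ih fun s hs => hQA s (Set.mem_insert_of_mem _ hs)
      have hs := hQA s (Set.mem_insert _ _)
      obtain ⟨h1, h2, h3⟩ := hmul a haA _ hs.mem hae hs.occ_eq
      refine ⟨_, h1, h2, fun s' hs' i hi => ?_⟩
      rcases hs' with rfl | hs'
      · exact (h3 i hi).2
      · exact (ha s' hs' i hi).trans (h3 i hi).1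
  let _ : Semigroup (TauAMPol n) := { mul := TauAMPol.acomp, mul_assoc := acomp_assoc }
  let _ : TopologicalSpace (TauAMPol n) := ⊥
  have : DiscreteTopology (TauAMPol n) := ⟨rfl⟩
  obtain ⟨g, hg, hgg⟩ := exists_idempotent_in_compact_subsemigroup
    (fun _ => continuous_of_discreteTopology) (I Q) hne
    ((A.finite_toSet.subset fun a ha => ha.1).isCompact) fun a ha b hb => by
      obtain ⟨h1, h2, h3⟩ := hmul a ha.1 b hb.1 ha.2.1 hb.2.1
      exact ⟨h1, h2, fun s hs i hi => (ha.2.2 s hs i hi).trans (h3 i hi).1⟩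
  exact ⟨g, hg.1, hgg, hg.2.1, hg.2.2⟩

theorem exists_coeff_le {Q : Set (TauMPol n)} (hQ : Q.Finite) :
    ∃ K, ∀ s ∈ Q, ∀ i m, (s i).coeff m ≤ K := by
  induction Q, hQ using Set.Finite.induction_on with
  | empty => exact ⟨0, fun s hs => hs.elim⟩
  | @insert s Q _ _ ih =>
    obtain ⟨K, hK⟩ := ih
    refine ⟨K + ∑ i, ∑ m ∈ (s i).support, (s i).coeff m, fun s' hs' i m => ?_⟩
    rcases hs' with rfl | hs'
    · by_cases hm : m ∈ (s' i).support
      · refine le_trans ?_ (Nat.le_add_left _ _)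
        refine le_trans ?_ (Finset.single_le_sum
          (f := fun i => ∑ m ∈ (s' i).support, (s' i).coeff m)
          (fun _ _ => Nat.zero_le _) (Finset.mem_univ i))
        exact Finset.single_le_sum (f := fun m => (s' i).coeff m) (fun _ _ => Nat.zero_le _) hm
      · rw [MvPolynomial.notMem_support_iff.1 hm]
        exact Nat.zero_le _
    · exact (hK s' hs' i m).trans (Nat.le_add_right _ _)

theorem exists_eq_single_add {p : TauPol n} {m : TauMon n} (h : m ∈ p.support) :
    ∃ r : TauPol n, p = MvPolynomial.monomial m 1 + r := by
  classical
  refine ⟨MvPolynomial.monomial m (p.coeff m - 1) +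
    ∑ d ∈ p.support.erase m, MvPolynomial.monomial d (p.coeff d), ?_⟩
  conv_lhs => rw [MvPolynomial.as_sum p, ← Finset.add_sum_erase _ _ h]
  rw [← add_assoc, ← map_add]
  have := Nat.one_le_iff_ne_zero.2 (MvPolynomial.mem_support_iff.1 h)
  rw [Nat.add_sub_cancel' this]

/-- The growth of a self-dependent variable `x_i` in one step. -/
theorem val_le_add_sum (hS : IsPolynomiallyBounded S) {b c : TauMPol n} {i : Fin n}
    (hi : Finsupp.single (some i) 1 ∈ abstraction b i)
    (hci : Finsupp.single (some i) 1 ∈ abstraction c i) (hbc : Good S (b.comp c))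
    {K : ℕ} (hK : ∀ m, (b.comp c i).coeff m ≤ K) {G : Finset (TauMon n)}
    (hG : selfDepPart e (abstraction (b.comp c)) i ⊆ G)
    {y z : Fin n → ℕ} (hz : ∀ j, ¬ e j j → z j = 0) (hzy : z ≤ y) {s T : ℕ} (hT : s ≤ T)
    (hy : y ≤ c.val z T) : b.val y s i ≤ y i + K * ∑ m ∈ G, monVal m y T := by
  classical
  obtain ⟨r, hr⟩ := exists_eq_single_add hi
  -- With `b i = x_i + r`, the polynomial `f` is `r` after `c`, so component `i` of `b ∘ c` is `c i
  -- + f`.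
  set f : TauPol n := TauMPol.comp (fun _ => r) c i with hf
  have hcomp : b.comp c i = c i + f := by
    have h1 : b.comp c i = MvPolynomial.bind₁
      (fun o : Option (Fin n) => o.elim (MvPolynomial.X none) c) (b i) := rfl
    rw [h1, hr, map_add]
    congr 1
    exact MvPolynomial.bind₁_X_right _ _
  -- The component `c i` already uses up the single copy of `x_i` allowed in `b ∘ c`.
  have hcoeff : f.coeff (Finsupp.single (some i) 1) = 0 := by
    have h1 := hbc.coeff_single_le_one hS i
    rw [hcomp, MvPolynomial.coeff_add] at h1
    have h2 : (c i).coeff (Finsupp.single (some i) 1) ≠ 0 := MvPolynomial.mem_support_iff.1 hci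
    omega
  have hval : b.val y s i = y i + r.value y s := by
    unfold TauMPol.val
    rw [hr, TauPol.value_add, TauPol.value_monomial, one_mul, monVal_single_some]
  rw [hval]
  refine Nat.add_le_add_left ?_ _
  have h1 : r.value y s ≤ f.value z T := by
    have h2 := congrFun (TauMPol.val_comp (fun _ => r : TauMPol n) c z T) i
    change f.value z T = r.value (c.val z T) T at h2
    rw [h2]
    exact TauPol.value_mono (fun j _ => hy j) hT
  refine h1.trans ?_
  rw [f.value_eq_sum, Finset.mul_sum]
  -- Outside `G` there remain only `x_i`, with coefficient `0` in `f`, and monomials with a variable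
  -- that is not self-dependent, which vanish at `z`.
  have h3 : ∀ m ∈ f.support, m ∉ G → f.coeff m * monVal m z T = 0 := by
    intro m hm hmG
    have hmb : m ∈ abstraction (b.comp c) i := by
      unfold abstraction
      rw [hcomp]
      exact mem_support_add_iff.2 (Or.inr hm)
    by_cases hmi : m = Finsupp.single (some i) 1
    · rw [hmi, hcoeff, zero_mul]
    · have : ¬ ∀ j, m (some j) ≠ 0 → e j j := fun h => hmG (hG ⟨hmb, hmi, h⟩)
      push Not at this
      obtain ⟨j, hj, hjj⟩ := this
      obtain ⟨m', rfl⟩ := exists_add_single hj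
      rw [monVal_add, monVal_single_some, hz j hjj, zero_mul, mul_zero]
  rw [← Finset.sum_filter_add_sum_filter_not f.support (· ∈ G),
    Finset.sum_eq_zero (s := f.support.filter fun m => ¬ m ∈ G) fun m hm =>
      h3 m (Finset.mem_filter.1 hm).1 (Finset.mem_filter.1 hm).2, add_zero]
  refine (Finset.sum_le_sum fun m _ => Nat.mul_le_mul ?_
    (monVal_mono (fun j _ => hzy j) le_rfl)).trans (Finset.sum_le_sum_of_subset fun m hm =>
      (Finset.mem_filter.1 hm).2)
  refine le_trans ?_ (hK m)
  rw [hcomp, MvPolynomial.coeff_add]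
  exact Nat.le_add_left _ _

end Prods


variable {n : ℕ} {S : Finset (MPol n)} {A : Finset (TauAMPol n)}

/-! ## Iteration of transitions with the same idempotent dependence relation -/

/-- A monomial of `tauPart` may coincide with `τ` times one of `freePart`, and the union keeps a
single copy; replacing `τ` by `2 τ` makes up for the loss. -/
theorem sum_tauPart_add_sum_freePart_le {p : TauAMPol n} {i : Fin n} (hi : occ p i i)
    (x : Fin n → ℕ) (t : ℕ) : x i + ∑ m ∈ p.tauPart i, monVal m x t +
      (∑ m ∈ p.freePart i, monVal m x t) * t ≤ (rescale 2 p.generalize).val x t i := by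
  classical
  rw [val_rescale, generalize_of_selfDep hi]
  set U := p.tauPart i ∪ (p.freePart i).image fun m => m + Finsupp.single none 1 with hU
  have hU0 : ∀ m ∈ U, m none ≠ 0 := by
    intro m hm
    rcases Finset.mem_union.1 hm with hm | hm
    · exact (Finset.mem_filter.1 hm).2.2.2
    · obtain ⟨m', _, rfl⟩ := Finset.mem_image.1 hm
      simp
  have hsingle : Finsupp.single (some i) 1 ∉ U := fun h => hU0 _ h (by simp)
  have h1 : ∑ m ∈ p.tauPart i, monVal m x t + (∑ m ∈ p.freePart i, monVal m x t) * t ≤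
      2 * ∑ m ∈ U, monVal m x t := by
    have h2 : ∑ m ∈ (p.freePart i).image (fun m => m + Finsupp.single none 1), monVal m x t =
        (∑ m ∈ p.freePart i, monVal m x t) * t := by
      rw [Finset.sum_image fun a _ b _ h => add_right_cancel h, Finset.sum_mul]
      exact Finset.sum_congr rfl fun m _ => by rw [monVal_add, monVal_single_none]
    rw [← h2, two_mul]
    exact Nat.add_le_add (Finset.sum_le_sum_of_subset Finset.subset_union_left)
      (Finset.sum_le_sum_of_subset Finset.subset_union_right)
  calc _ = x i + (∑ m ∈ p.tauPart i, monVal m x t + (∑ m ∈ p.freePart i, monVal m x t) * t) :=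
        add_assoc _ _ _
    _ ≤ x i + ∑ m ∈ U, monVal m x (2 * t) := by
        refine Nat.add_le_add_left (h1.trans ?_) _
        rw [Finset.mul_sum]
        exact Finset.sum_le_sum fun m hm => mul_monVal_le (hU0 m hm) 2 x t
    _ = ∑ m ∈ insert (Finsupp.single (some i) 1) U, monVal m x (2 * t) := by
        rw [Finset.sum_insert hsingle, monVal_single_some]
    _ ≤ _ := by
        refine Finset.sum_le_sum_of_subset fun m hm => ?_
        simp only [hU, Finset.mem_insert, Finset.mem_union, Finset.mem_singleton] at hm ⊢
        tauto

theorem sum_monVal_le {m : TauMon n} (hm : m none ≠ 0) (x : Fin n → ℕ) (s : Finset ℕ)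
    (T : ℕ → ℕ) : ∑ l ∈ s, monVal m x (T l) ≤ monVal m x (∑ l ∈ s, T l) := by
  classical
  induction s using Finset.induction_on with
  | empty => simp
  | insert l s hl ih =>
    rw [Finset.sum_insert hl, Finset.sum_insert hl]
    exact (Nat.add_le_add_left ih _).trans (monVal_add_le hm _ _ _)

/-- The sum of the values of `τ` over the steps from `l - n` to `l`. -/
def window (n : ℕ) (τ : ℕ → ℕ) (l : ℕ) : ℕ := ∑ d ∈ Finset.range (n + 1), τ (l - d)

theorem le_window (n : ℕ) (τ : ℕ → ℕ) (l : ℕ) {d : ℕ} (hd : d ≤ n) : τ (l - d) ≤ window n τ l :=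
  Finset.single_le_sum (f := fun d => τ (l - d)) (fun _ _ => Nat.zero_le _)
    (Finset.mem_range.2 (Nat.lt_succ_of_le hd))

/-- Each `τ l` occurs in at most `n + 1` windows. -/
theorem sum_window_le (n : ℕ) (τ : ℕ → ℕ) (k : ℕ) :
    ∑ l ∈ Finset.Ico n k, window n τ l ≤ (n + 1) * ∑ l ∈ Finset.range k, τ l := by
  classical
  unfold window
  rw [Finset.sum_comm]
  calc _ ≤ ∑ _d ∈ Finset.range (n + 1), ∑ l ∈ Finset.range k, τ l := by
        refine Finset.sum_le_sum fun d hd => ?_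
        have hd' := Finset.mem_range.1 hd
        rw [← Finset.sum_image (f := τ) (g := fun l => l - d) (s := Finset.Ico n k)]
        · refine Finset.sum_le_sum_of_subset fun l hl => ?_
          obtain ⟨l', hl', rfl⟩ := Finset.mem_image.1 hl
          have := Finset.mem_Ico.1 hl'
          exact Finset.mem_range.2 (by omega)
        · intro a ha b hb hab
          have h1 := Finset.mem_Ico.1 (Finset.mem_coe.1 ha)
          have h2 := Finset.mem_Ico.1 (Finset.mem_coe.1 hb)
          simp only at hab
          omega
    _ = _ := by simp

theorem val_rescale_le (a : TauAMPol n) (D E t : ℕ) (x : Fin n → ℕ) :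
    (rescale D a).val x (E * t) = (rescale (D * E) a).val x t := by
  funext i
  rw [val_rescale, val_rescale, mul_assoc]

variable {e : Dep n} {B : Set (TauMPol n)}

/-- The bound for the self-dependent variables after many transitions. -/
theorem le_iterate_generalize (hS : IsPolynomiallyBounded S) (hA : Returns S A)
    (hAg : ∀ a ∈ A, AGood S a) (he : IsIdempotentElem e) (hB : ∀ b ∈ B, Adm S A e b)
    {g : TauAMPol n} (hgA : g ∈ A) (hge : occ g = e)
    (hg : ∀ s ∈ prods B (n + 1), ∀ i, e i i → selfDepPart e (abstraction s) i ⊆ selfDepPart e g i)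
    {K : ℕ} (hK : ∀ s ∈ prods B (n + 1), ∀ i m, (s i).coeff m ≤ K)
    {b : ℕ → TauMPol n} (hb : ∀ l, b l ∈ B) {τ : ℕ → ℕ} {y : ℕ → Fin n → ℕ}
    (hy : ∀ l, y (l + 1) = (b l).val (y l) (τ l)) {k t : ℕ} (hkt : k ≤ t)
    (hτ : ∑ l ∈ Finset.range k, τ l ≤ t) {l : ℕ} (hnl : n ≤ l) (hlk : l ≤ k) {i : Fin n}
    (hi : e i i) :
    y l i ≤ (prodSeq (fun _ => rescale (2 * ((K + 1) * (n + 1))) g.generalize) (n + 1)).val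
      (y n) t i := by
  classical
  -- The factor `n + 1` pays for overlapping windows and `K + 1` for the coefficients; the further
  -- factor `2` comes from `sum_tauPart_add_sum_freePart_le`.
  set E := (K + 1) * (n + 1) with hE
  set h := rescale (2 * E) g.generalize with hh
  have hmono : ∀ i, e i i → ∀ l l', l ≤ l' → y l i ≤ y l' i := by
    intro i hi l l' hll
    induction l', hll using Nat.le_induction with
    | base => exact le_rfl
    | succ l' _ ih =>
      rw [hy]
      exact ih.trans (le_val_of_single_mem ((hB _ (hb l')).single_mem hS hi) _ _)
  have hself : ∀ j, j ∈ g.selfDep ↔ e j j := fun j => by rw [← hge]; rfl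
  have hgself : ∀ m, g.IsSelfDepMon m ↔ ∀ j, m (some j) ≠ 0 → e j j := fun m =>
    forall_congr' fun j => imp_congr_right fun _ => hself j
  have hparts : ∀ i, selfDepPart e g i ⊆ (g.tauPart i ∪ g.freePart i : Finset _) := by
    intro i m hm
    have hm' := (hgself m).2 hm.2.2
    rw [Finset.mem_coe, Finset.mem_union]
    by_cases h0 : m none = 0
    · exact Or.inr (Finset.mem_filter.2 ⟨hm.1, hm.2.1, hm', h0⟩)
    · exact Or.inl (Finset.mem_filter.2 ⟨hm.1, hm.2.1, hm', h0⟩)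
  have hvars : ∀ i, e i i → ∀ m ∈ g.tauPart i ∪ g.freePart i, ∀ j, m (some j) ≠ 0 →
      e j j ∧ e i j ∧ j ≠ i := by
    intro i hi m hm j hj
    have hm' : m ∈ g i ∧ m ≠ Finsupp.single (some i) 1 ∧ g.IsSelfDepMon m := by
      rcases Finset.mem_union.1 hm with hm | hm
      · exact ⟨(Finset.mem_filter.1 hm).1, (Finset.mem_filter.1 hm).2.1,
          (Finset.mem_filter.1 hm).2.2.1⟩
      · exact ⟨(Finset.mem_filter.1 hm).1, (Finset.mem_filter.1 hm).2.1,
          (Finset.mem_filter.1 hm).2.2.1⟩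
    -- A monomial of component `i` that contains `x_i` equals `x_i`, which both parts exclude. Hence
    -- increments of `x_i` never involve `x_i` itself.
    refine ⟨(hself j).1 (hm'.2.2 j hj), by rw [← hge]; exact ⟨m, hm'.1, hj⟩, ?_⟩
    rintro rfl
    exact hm'.2.1 ((hAg g hgA).eq_single hS hm'.1 hj)
  have hstep : ∀ i, e i i → ∀ l, n ≤ l → y (l + 1) i ≤ y l i +
      K * ∑ m ∈ g.tauPart i ∪ g.freePart i, monVal m (y l) (window n τ l) := by
    intro i hi l hl
    set c := prodSeq (fun s => b (l - n + s)) n with hc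
    have hcB : c ∈ prods B n := prodSeq_mem (fun s => hb _) n
    have hbc : (b l).comp c ∈ prods B (n + 1) := ⟨_, hb l, _, hcB, rfl⟩
    -- Only the self-dependent values at time `l` are kept. They never decrease, so they dominate
    -- the preceding `n` states, and the last `n` transitions applied to `z` recover a bound on all
    -- of `y l`.
    set z : Fin n → ℕ := fun j => if e j j then y l j else 0 with hz
    have hflush := le_val_prodSeq_of_selfDep hS he hB (b := fun s => b (l - n + s))
      (fun s => hb _) (fun s => y (l - n + s)) z (window n τ l) (fun s hs => by
        have h1 := hy (l - n + s)
        rw [add_assoc] at h1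
        rw [h1]
        refine (b (l - n + s)).val_mono le_rfl ?_
        have h2 := le_window n τ l (d := n - s) (by omega)
        rwa [show l - (n - s) = l - n + s by omega] at h2) (fun s hs j hj => by
          simp only [hz, if_pos hj]
          exact hmono j hj _ _ (by omega))
    simp only [Nat.sub_add_cancel hl] at hflush
    rw [hy]
    exact val_le_add_sum hS ((hB _ (hb l)).single_mem hS hi) (single_mem_of_mem_prods hS hB hcB hi)
      (Adm.comp_prods hA he hB hcB (hB _ (hb l))).good (fun m => hK _ hbc i m)
      ((hg _ hbc i hi).trans (hparts i)) (fun j hj => by simp [hz, hj])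
      (fun j => by simp only [hz]; split_ifs <;> omega)
      (by simpa using le_window n τ l (d := 0) (Nat.zero_le _)) hflush
  have hhle : ∀ i, e i i → ∀ x t, x i ≤ h.val x t i := by
    intro i hi x t
    refine le_val_of_single_mem ?_ x t
    rw [hh, abstraction_rescale
        (Nat.mul_pos two_pos (Nat.mul_pos (Nat.succ_pos K) (Nat.succ_pos n))),
      generalize_of_selfDep (by rwa [hge])]
    simp
  set Z : ℕ → Fin n → ℕ := fun r => (prodSeq (fun _ => h) r).val (y n) t with hZ
  have hZs : ∀ r, Z (r + 1) = h.val (Z r) t := fun r => val_prodSeq_succ _ _ _ _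
  have hZ0 : ∀ r i, e i i → y n i ≤ Z r i := by
    intro r i hi
    induction r with
    | zero => simp only [hZ, val_prodSeq_zero]; exact le_rfl
    | succ r ih => rw [hZs]; exact ih.trans (hhle i hi _ _)
  -- By antisymmetry, every self-dependent variable in an increment of `x_i` has smaller rank. One
  -- application of `h` settles one more rank.
  let rank : Fin n → ℕ := fun i => (Finset.univ.filter fun k => e i k).card
  have key : ∀ r i, e i i → rank i < r → ∀ l, n ≤ l → l ≤ k → y l i ≤ Z r i := by
    intro r
    induction r with
    | zero => intro i _ hr; exact absurd hr (Nat.not_lt_zero _)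
    | succ r ih =>
      intro i hi hr
      have hlow : ∀ l, n ≤ l → l ≤ k → ∀ j, e j j ∧ e i j ∧ j ≠ i → y l j ≤ Z r j := by
        rintro l hl hlk j ⟨hjj, hij, hji⟩
        refine ih j hjj (lt_of_lt_of_le (Finset.card_lt_card ?_) (Nat.lt_succ_iff.1 hr)) l hl hlk
        refine (Finset.ssubset_iff_of_subset ?_).2 ⟨i, by simpa using hi, fun h => hji ?_⟩
        · intro k hk
          simp only [Finset.mem_filter, Finset.mem_univ, true_and] at hk ⊢
          exact Dep.trans_of_isIdempotentElem he hij hk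
        · exact (hB _ (hb 0)).antisymm hS he (by simpa using h) hij
      have hsum : ∀ l, n ≤ l → l ≤ k → y l i ≤ y n i + K * ∑ l' ∈ Finset.Ico n l,
          ∑ m ∈ g.tauPart i ∪ g.freePart i, monVal m (Z r) (window n τ l') := by
        intro l hl
        induction l, hl using Nat.le_induction with
        | base => intro _; exact Nat.le_add_right _ _
        | succ l hl ihl =>
          intro hlk
          rw [Finset.sum_Ico_succ_top hl, mul_add, ← add_assoc]
          refine (hstep i hi l hl).trans (Nat.add_le_add (ihl (by omega))
            (Nat.mul_le_mul_left _ (Finset.sum_le_sum fun m hm => ?_)))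
          exact monVal_mono (fun j hj => hlow l hl (by omega) j (hvars i hi m hm j hj)) le_rfl
      intro l hl hlk
      refine (hsum l hl hlk).trans ?_
      have hw : ∑ l' ∈ Finset.Ico n l, window n τ l' ≤ (n + 1) * t := by
        refine (sum_window_le n τ l).trans (Nat.mul_le_mul_left _ (le_trans ?_ hτ))
        exact Finset.sum_le_sum_of_subset (Finset.range_mono hlk)
      -- Monomials with `τ` are superadditive in `τ`, so their increments sum to one value at the
      -- total weight. Those without `τ` contribute a constant at most `t` times, see `h2`.
      have h1 : ∑ l' ∈ Finset.Ico n l, ∑ m ∈ g.tauPart i, monVal m (Z r) (window n τ l') ≤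
          ∑ m ∈ g.tauPart i, monVal m (Z r) ((n + 1) * t) := by
        rw [Finset.sum_comm]
        exact Finset.sum_le_sum fun m hm =>
          (sum_monVal_le (Finset.mem_filter.1 hm).2.2.2 _ _ _).trans
            (monVal_mono (fun _ _ => le_rfl) hw)
      have h2 : ∑ l' ∈ Finset.Ico n l, ∑ m ∈ g.freePart i, monVal m (Z r) (window n τ l') ≤
          t * ∑ m ∈ g.freePart i, monVal m (Z r) (E * t) := by
        calc _ = ∑ l' ∈ Finset.Ico n l, ∑ m ∈ g.freePart i, monVal m (Z r) (E * t) :=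
              Finset.sum_congr rfl fun l' _ => Finset.sum_congr rfl fun m hm =>
                monVal_eq_of_tau_free (Finset.mem_filter.1 hm).2.2.2 _ _ _
          _ = (l - n) * ∑ m ∈ g.freePart i, monVal m (Z r) (E * t) := by simp
          _ ≤ _ := Nat.mul_le_mul_right _ (by omega)
      have h3 : K * ∑ m ∈ g.tauPart i, monVal m (Z r) ((n + 1) * t) ≤
          ∑ m ∈ g.tauPart i, monVal m (Z r) (E * t) := by
        rw [Finset.mul_sum]
        refine Finset.sum_le_sum fun m hm =>
          (mul_monVal_le (Finset.mem_filter.1 hm).2.2.2 K _ _).trans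
            (monVal_mono (fun _ _ => le_rfl) ?_)
        rw [hE, mul_assoc]
        exact Nat.mul_le_mul_right _ (Nat.le_succ K)
      have h4 : K * (t * ∑ m ∈ g.freePart i, monVal m (Z r) (E * t)) ≤
          (∑ m ∈ g.freePart i, monVal m (Z r) (E * t)) * (E * t) := by
        rw [← mul_assoc, mul_comm _ (E * t)]
        refine Nat.mul_le_mul_right _ (Nat.mul_le_mul_right _ ?_)
        rw [hE]
        exact (Nat.le_succ K).trans (Nat.le_mul_of_pos_right _ (Nat.succ_pos n))
      have h5 := sum_tauPart_add_sum_freePart_le (p := g) (i := i) (by rwa [hge]) (Z r) (E * t)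
      rw [val_rescale_le, ← hh, ← hZs] at h5
      have h6 := hZ0 r i hi
      have h7 : ∑ l' ∈ Finset.Ico n l,
          ∑ m ∈ g.tauPart i ∪ g.freePart i, monVal m (Z r) (window n τ l') ≤
          ∑ m ∈ g.tauPart i, monVal m (Z r) ((n + 1) * t) +
            t * ∑ m ∈ g.freePart i, monVal m (Z r) (E * t) := by
        refine le_trans ?_ (Nat.add_le_add h1 h2)
        rw [← Finset.sum_add_distrib]
        exact Finset.sum_le_sum fun l' _ => sum_union_le _ _ _
      have h8 := Nat.mul_le_mul_left K h7
      rw [mul_add] at h8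
      omega
  refine key (n + 1) i hi (Nat.lt_succ_of_le ?_) l hnl hlk
  exact (Finset.card_le_univ _).trans (by simp)

/-- All sequences of transitions from `B` are bounded by finitely many multi-polynomials. -/
theorem exists_bounds_of_idempotent (hS : IsPolynomiallyBounded S) (hA : Returns S A)
    (hAg : ∀ a ∈ A, AGood S a) (he : IsIdempotentElem e) (hB : ∀ b ∈ B, Adm S A e b)
    (hBf : B.Finite) (hBne : B.Nonempty) :
    ∃ Q : Set (TauMPol n), Q.Finite ∧ (∀ q ∈ Q, Adm S A e q) ∧
      ∀ (b : ℕ → TauMPol n) (τ : ℕ → ℕ) (k : ℕ), (∀ l, b l ∈ B) → 1 ≤ k → ∃ q ∈ Q,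
        ∀ (y : ℕ → Fin n → ℕ) (t : ℕ), (∀ l, y (l + 1) = (b l).val (y l) (τ l)) → k ≤ t →
          ∑ l ∈ Finset.range k, τ l ≤ t → y k ≤ q.val (y 0) t := by
  obtain ⟨b₀, hb₀⟩ := hBne
  obtain ⟨g, hgA, hgid, hge, hg⟩ := exists_idempotent hA he hS hAg (finite_prods hBf (n + 1))
    (fun s hs => Adm.of_mem_prods hA he hB hs) (hB b₀ hb₀)
  obtain ⟨K, hK⟩ := exists_coeff_le (finite_prods hBf (n + 1))
  set h := rescale (2 * ((K + 1) * (n + 1))) g.generalize with hh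
  have hD : 1 ≤ 2 * ((K + 1) * (n + 1)) :=
    Nat.mul_pos two_pos (Nat.mul_pos (Nat.succ_pos K) (Nat.succ_pos n))
  have hocc : occ g.generalize = e := by
    rw [occ_generalize fun i hi => (hAg g hgA).single_mem hS hi, hge]
  have hhA : Adm S A e h := by
    have hmem := hA.generalize_mem hgA hgid
    refine ⟨Good.rescale hD (hAg _ hmem), ?_, ?_⟩
    · rwa [hh, abstraction_rescale hD]
    · rwa [hh, abstraction_rescale hD]
  have hH : Adm S A e (prodSeq (fun _ => h) (n + 1)) :=
    Adm.of_mem_prods hA he (B := {h}) (by rintro b rfl; exact hhA)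
      (prodSeq_mem (fun _ => Set.mem_singleton h) (n + 1))
  set H := prodSeq (fun _ => h) (n + 1) with hHdef
  -- Short sequences are composed outright. In long ones `c'` is the first `n` transitions, which
  -- the windows require, `H` bounds the self-dependent variables, and the last `n` transitions `c`
  -- recover the others.
  refine ⟨(⋃ m ∈ Set.Iio n, prods B (m + 1)) ∪
    Set.image2 (fun c c' => c.comp (H.comp c')) (prods B n) (prods B n), ?_, ?_, ?_⟩
  · exact ((Set.finite_Iio n).biUnion fun m _ => finite_prods hBf _).union
      ((finite_prods hBf n).image2 _ (finite_prods hBf n))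
  · rintro q (hq | ⟨c, hc, c', hc', rfl⟩)
    · simp only [Set.mem_iUnion] at hq
      obtain ⟨m, _, hq⟩ := hq
      exact Adm.of_mem_prods hA he hB hq
    · exact Adm.prods_comp hA he hB hc (Adm.comp_prods hA he hB hc' hH)
  · intro b τ k hb hk
    have hpre : ∀ (y : ℕ → Fin n → ℕ) (t : ℕ), (∀ l, y (l + 1) = (b l).val (y l) (τ l)) →
        ∑ l ∈ Finset.range k, τ l ≤ t → ∀ m ≤ k, y m ≤ (prodSeq b m).val (y 0) t := by
      intro y t hy hτ m
      induction m with
      | zero => intro _; rw [val_prodSeq_zero]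
      | succ m ih =>
        intro hm
        rw [hy, val_prodSeq_succ]
        refine (b m).val_mono (ih (by omega)) (le_trans ?_ hτ)
        exact Finset.single_le_sum (f := τ) (fun _ _ => Nat.zero_le _)
          (Finset.mem_range.2 (by omega))
    by_cases hkn : k ≤ n
    · refine ⟨prodSeq b k, Or.inl ?_, fun y t hy _ hτ => hpre y t hy hτ k le_rfl⟩
      obtain ⟨m, rfl⟩ : ∃ m, k = m + 1 := ⟨k - 1, by omega⟩
      exact Set.mem_biUnion (show m ∈ Set.Iio n from hkn) (prodSeq_mem hb (m + 1))
    · refine ⟨(prodSeq (fun s => b (k - n + s)) n).comp (H.comp (prodSeq b n)),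
        Or.inr ⟨_, prodSeq_mem (fun s => hb _) n, _, prodSeq_mem hb n, rfl⟩, ?_⟩
      intro y t hy hkt hτ
      rw [TauMPol.val_comp, TauMPol.val_comp]
      have hmid : ∀ l ≤ k, ∀ i, e i i → y l i ≤ H.val (y n) t i := by
        intro l hl i hi
        by_cases hln : n ≤ l
        · exact le_iterate_generalize hS hA hAg he hB hgA hge hg hK hb hy hkt hτ hln hl hi
        -- If `k < 2 * n`, the last `n` transitions begin before time `n`; monotonicity of the
        -- self-dependent variables covers these times.
        · refine le_trans ?_ (le_iterate_generalize hS hA hAg he hB hgA hge hg hK hb hy hkt hτ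
            le_rfl (by omega) hi)
          have : ∀ l', l ≤ l' → y l i ≤ y l' i := by
            intro l' hll
            induction l', hll using Nat.le_induction with
            | base => exact le_rfl
            | succ l' _ ih =>
              rw [hy]
              exact ih.trans (le_val_of_single_mem ((hB _ (hb l')).single_mem hS hi) _ _)
          exact this n (by omega)
      have hflush := le_val_prodSeq_of_selfDep hS he hB (b := fun s => b (k - n + s))
        (fun s => hb _) (fun s => y (k - n + s)) (H.val (y n) t) t (fun s hs => by
          have h1 := hy (k - n + s)
          rw [add_assoc] at h1
          rw [h1]
          refine (b (k - n + s)).val_mono le_rfl (le_trans ?_ hτ)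
          exact Finset.single_le_sum (f := τ) (fun _ _ => Nat.zero_le _)
            (Finset.mem_range.2 (by omega))) (fun s hs j hj => hmid _ (by omega) j hj)
      simp only [Nat.sub_add_cancel (show n ≤ k by omega)] at hflush
      refine hflush.trans (TauMPol.val_mono _ (TauMPol.val_mono _ ?_ le_rfl) le_rfl)
      exact hpre y t hy hτ n (by omega)

/-! ## The bound for all traces -/

/-- The dependence relation of a trace. -/
def depWord (σ : List (MPol n)) : Dep n := (σ.map fun p => occ (abstraction p.toTau)).prod

theorem depWord_append (σ ρ : List (MPol n)) : depWord (σ ++ ρ) = depWord σ * depWord ρ := by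
  simp [depWord]

/-- All traces in `L` are bounded by finitely many multi-polynomials with abstraction in `A`. -/
def FinitelyBounded (S : Finset (MPol n)) (A : Finset (TauAMPol n)) (L : Language (MPol n)) :
    Prop :=
  ∃ Q : Set (TauMPol n), Q.Finite ∧ ∀ σ ∈ L, ∃ q ∈ Q, Adm S A (depWord σ) q ∧ Bounds q σ

open Computability

/-- Each factor is replaced by one of finitely many bounds evaluated at its own weight; the
resulting sequence of states is covered by `exists_bounds_of_idempotent`. -/
theorem FinitelyBounded.star (hS : IsPolynomiallyBounded S) (hA : Returns S A)
    (hAg : ∀ a ∈ A, AGood S a) (he : IsIdempotentElem e) {L : Language (MPol n)}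
    (hLe : ∀ σ ∈ L, depWord σ = e) (hL : FinitelyBounded S A L) : FinitelyBounded S A (L∗) := by
  classical
  obtain ⟨Q₀, hQ₀, hL⟩ := hL
  set B : Set (TauMPol n) := {b | b ∈ Q₀ ∧ Adm S A e b} with hBdef
  have hB : ∀ b ∈ B, Adm S A e b := fun b hb => hb.2
  rcases B.eq_empty_or_nonempty with hBe | hBne
  · refine ⟨{TauMPol.one}, Set.finite_singleton _, ?_⟩
    rintro σ ⟨ws, rfl, hws⟩
    cases ws with
    | nil => exact ⟨_, rfl, Adm.one hA, bounds_one_nil⟩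
    | cons w ws =>
      obtain ⟨q, hq, hqA, _⟩ := hL w (hws w (by simp))
      rw [hLe w (hws w (by simp))] at hqA
      have : q ∈ B := ⟨hq, hqA⟩
      rw [hBe] at this
      exact this.elim
  obtain ⟨Q, hQ, hQA, hQb⟩ := exists_bounds_of_idempotent hS hA hAg he hB
    (hQ₀.subset fun b hb => hb.1) hBne
  obtain ⟨b₀, hb₀⟩ := hBne
  -- The empty trace has dependence relation `1`, not necessarily `e`, and needs its own bound.
  refine ⟨insert TauMPol.one Q, hQ.insert _, fun σ hσ => ?_⟩
  obtain ⟨ws, rfl, hws⟩ := Language.mem_kstar_iff_exists_nonempty.1 hσ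
  rcases Nat.eq_zero_or_pos ws.length with h0 | hpos
  · rw [List.length_eq_zero_iff.1 h0]
    exact ⟨_, Set.mem_insert _ _, Adm.one hA, bounds_one_nil⟩
  have hdep : ∀ us : List (List (MPol n)), us ≠ [] → (∀ u ∈ us, depWord u = e) →
      depWord us.flatten = e := by
    intro us
    induction us with
    | nil => intro h; exact absurd rfl h
    | cons u us ih =>
      intro _ hus
      rw [List.flatten_cons, depWord_append, hus u (by simp)]
      by_cases hus' : us = []
      · subst hus'
        simp [depWord]
      · rw [ih hus' fun v hv => hus v (by simp [hv]), he.eq]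
  -- Past the end of the list, `b₀` is a filler: the sequence of transitions is infinite, but only
  -- its first `ws.length` members matter.
  have hex : ∀ l, ∃ b ∈ B, Bounds b (ws.getD l []) ∨ ws.length ≤ l := by
    intro l
    by_cases hl : l < ws.length
    · have hmem : ws.getD l [] ∈ ws := by
        rw [List.getD_eq_getElem _ _ hl]
        exact List.getElem_mem hl
      obtain ⟨q, hq, hqA, hqb⟩ := hL _ (hws _ hmem).1
      rw [hLe _ (hws _ hmem).1] at hqA
      exact ⟨q, ⟨hq, hqA⟩, Or.inl hqb⟩
    · exact ⟨b₀, hb₀, Or.inr (by omega)⟩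
  choose b hbB hbb using hex
  set τ : ℕ → ℕ := fun l => weight (ws.getD l []) with hτ
  obtain ⟨q, hq, hbound⟩ := hQb b τ ws.length hbB hpos
  refine ⟨q, Set.mem_insert_of_mem _ hq, ?_, ?_⟩
  · rw [hdep ws (List.length_pos_iff.1 hpos) fun u hu => hLe u (hws u hu).1]
    exact hQA q hq
  rw [bounds_iff]
  intro x t ht
  let y : ℕ → Fin n → ℕ := fun l => Nat.rec x (fun l z => (b l).val z (τ l)) l
  have hrun : ∀ l ≤ ws.length, run (ws.take l).flatten x ≤ y l := by
    intro l
    induction l with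
    | zero => intro _; exact le_rfl
    | succ l ih =>
      intro hl
      have hl' : l < ws.length := hl
      rw [List.take_succ_eq_append_getElem hl', List.flatten_append, run_append,
        List.flatten_singleton]
      have hb := (hbb l).resolve_right (by omega)
      rw [bounds_iff] at hb
      have h1 := hb (y l) (τ l) le_rfl
      rw [List.getD_eq_getElem _ _ hl'] at h1
      exact (run_mono _ (ih (by omega))).trans h1
  have hsum : ∑ l ∈ Finset.range ws.length, τ l = weight ws.flatten := by
    have : ∀ us : List (List (MPol n)),
        ∑ l ∈ Finset.range us.length, weight (us.getD l []) = weight us.flatten := by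
      intro us
      induction us with
      | nil => rfl
      | cons u us ih =>
        rw [List.length_cons, Finset.sum_range_succ', List.flatten_cons, weight_append, ← ih,
          add_comm]
        rfl
    exact this ws
  -- Empty factors were discarded, so the number of iterations is also at most the weight of the
  -- trace and may be measured by `t`.
  have hlen : ws.length ≤ weight ws.flatten := by
    rw [← hsum]
    calc ws.length = ∑ _l ∈ Finset.range ws.length, 1 := by simp
      _ ≤ _ := Finset.sum_le_sum fun l hl => by
        have hl' := Finset.mem_range.1 hl
        have h1 := (hws _ (List.getElem_mem hl')).2
        change 1 ≤ weight (ws.getD l [])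
        rw [List.getD_eq_getElem _ _ hl']
        exact List.length_pos_iff.2 h1
  have h1 := hrun ws.length le_rfl
  rw [List.take_length] at h1
  exact h1.trans (hbound y t (fun _ => rfl) (hlen.trans ht) (hsum.le.trans ht))

theorem isFactorizationClosed_finitelyBounded (hS : IsPolynomiallyBounded S) (hA : Returns S A)
    (hAg : ∀ a ∈ A, AGood S a) :
    IsFactorizationClosed (depWord (n := n)) (FinitelyBounded S A) where
  mono := fun hKL ⟨Q, hQ, h⟩ => ⟨Q, hQ, fun σ hσ => h σ (hKL hσ)⟩
  one := ⟨{TauMPol.one}, Set.finite_singleton _, fun σ hσ => by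
    rw [show σ = [] from hσ]
    exact ⟨_, rfl, Adm.one hA, bounds_one_nil⟩⟩
  add := fun ⟨Q, hQ, h⟩ ⟨Q', hQ', h'⟩ => ⟨Q ∪ Q', hQ.union hQ', fun σ hσ => by
    rcases hσ with hσ | hσ
    · obtain ⟨q, hq, h⟩ := h σ hσ
      exact ⟨q, Or.inl hq, h⟩
    · obtain ⟨q, hq, h⟩ := h' σ hσ
      exact ⟨q, Or.inr hq, h⟩⟩
  mul := fun ⟨Q, hQ, h⟩ ⟨Q', hQ', h'⟩ => ⟨Set.image2 TauMPol.comp Q' Q, hQ'.image2 _ hQ, by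
    rintro _ ⟨σ, hσ, ρ, hρ, rfl⟩
    obtain ⟨q, hq, hqA, hqb⟩ := h σ hσ
    obtain ⟨q', hq', hqA', hqb'⟩ := h' ρ hρ
    refine ⟨_, ⟨q', hq', q, hq, rfl⟩, ?_, hqb.append hqb'⟩
    change Adm S A (depWord (σ ++ ρ)) _
    rw [depWord_append]
    exact hqA'.comp hA hqA⟩
  star := fun he hLe hL => hL.star hS hA hAg he hLe

end

end SDL

/-! ### The main theorem -/

theorem mainTheorem3 (n : ℕ) (S : Finset (SDL.MPol n))
    (hvars : ∀ p ∈ S, ∀ i : Fin n, (p i).vars.Nonempty)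
    (hS : SDL.IsPolynomiallyBounded S) :
    ∃ A : Finset (SDL.TauAMPol n), SDL.Returns S A ∧
      ∃ B : Finset (SDL.TauMPol n),
        (∀ p ∈ B, SDL.abstraction p ∈ A) ∧
        ∀ σ : List (SDL.MPol n), SDL.IsTrace S σ → ∃ p ∈ B, SDL.Bounds p σ := by
  classical
  obtain ⟨A, hA, hAg⟩ := SDL.exists_returns hS hvars
  refine ⟨A, hA, ?_⟩
  let L : Language (SDL.MPol n) := {w | ∃ p ∈ S, w = [p]}
  have hL : SDL.FinitelyBounded S A L := by
    refine ⟨SDL.MPol.toTau '' (S : Set (SDL.MPol n)), S.finite_toSet.image _, ?_⟩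
    rintro _ ⟨p, hp, rfl⟩
    refine ⟨_, ⟨p, hp, rfl⟩, ?_, SDL.bounds_toTau p⟩
    have := SDL.Adm.toTau hA hp (hvars p hp)
    simpa [SDL.depWord] using this
  -- The traces over `S` are the words of `L∗`, with `L` the one-letter words.
  obtain ⟨Q, hQ, h⟩ := (SDL.isFactorizationClosed_finitelyBounded hS hA hAg).kstar rfl
    SDL.depWord_append hL
  refine ⟨hQ.toFinset.filter fun q => SDL.abstraction q ∈ A,
    fun p hp => (Finset.mem_filter.1 hp).2, fun σ hσ => ?_⟩
  have hσL : σ ∈ KStar.kstar L := by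
    refine ⟨σ.map fun p => [p], (List.flatMap_singleton' σ).symm, fun w hw => ?_⟩
    obtain ⟨p, hp, rfl⟩ := List.mem_map.1 hw
    exact ⟨p, hσ p hp, rfl⟩
  obtain ⟨q, hq, hqA, hqb⟩ := h σ hσL
  exact ⟨q, Finset.mem_filter.2 ⟨hQ.mem_toFinset.2 hq, hqA.mem⟩, hqb⟩
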